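/- A skew brace $(B,+,\ast)$ is a set $B$ with two binary operations such that $(B,+)$ and $(B,\ast)$ are groups (neither assumed abelian) and $a\ast(b+c)=(a\ast b)+(-a)+(a\ast c)$ for all $a,b,c\in B$; an isomorphism of skew braces is a bijection that preserves both operations. For positive integers $d,e$ and an integer $k$ put $$G(d,e,k)=\langle \sigma,\tau : \sigma^e=\tau^d=1,\ \tau\sigma\tau^{-1}=\sigma^k\rangle .$$ Theorem. Let $n\ge 1$ be squarefree. Let $d,e,\delta,\epsilon$ be positive integers with $n=de=\delta\epsilon$ and $\gcd(d,e)=\gcd(\delta,\epsilon)=1$. Let $k$ be an integer coprime to $e$ whose order in $(\mathbb{Z}/e\mathbb{Z})^\times$ is $d$, and $\kappa$ an integer coprime to $\epsilon$ whose order in $(\mathbb{Z}/\epsilon\mathbb{Z})^\times$ is $\delta$. Let $M\cong G(\delta,\epsilon,\kappa)$ and $A\cong G(d,e,k)$. Set $$g=\frac{e}{\gcd(k-1,e)},\qquad \gamma=\frac{\epsilon}{\gcd(\kappa-1,\epsilon)},\qquad w=\varphi(\gcd(\delta,d)),$$ where $\varphi$ is the Euler totient function, and let $\omega(g)$ be the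 number of distinct prime factors of $g$. Then the number $b(M,A)$ of isomorphism classes of skew braces $(B,+,\ast)$ with $(B,\ast)\cong M$ and $(B,+)\cong A$ is $$b(M,A)=\begin{cases}2^{\omega(g)}\,w & \text{if } \gamma\mid e,\\ 0 & \text{if } \gamma\nmid e.\end{cases}$$ -/

import Mathlib

universe u


/-- The group `G(d,e,k) = ⟨σ, τ : σ ^ e = τ ^ d = 1, τ σ τ⁻¹ = σ ^ k⟩`, with `σ`, `τ` the
generators `0`, `1`. -/
abbrev MetacyclicGroup (d e : ℕ) (k : ℤ) : Type :=
  PresentedGroup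
    ({FreeGroup.of 0 ^ e,
      FreeGroup.of 1 ^ d,
      FreeGroup.of 1 * FreeGroup.of 0 * (FreeGroup.of 1)⁻¹ * (FreeGroup.of 0 ^ k)⁻¹} :
      Set (FreeGroup (Fin 2)))

/-- A skew (left) brace: two group structures, `+` (not necessarily commutative) and `*`, on the
same set, with `a * (b + c) = a * b - a + a * c`. -/
class SkewBrace (B : Type*) extends AddGroup B, Group B where
  mul_add_skew : ∀ a b c : B, a * (b + c) = a * b + (-a) + a * c

/-- A skew brace whose multiplicative group is isomorphic to `M` and whose additive group is
isomorphic to `A` (the group `A` is written multiplicatively). -/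
structure SkewBraceOver (M A : Type u) [Group M] [Group A] where
  carrier : Type u
  [skewBrace : SkewBrace carrier]
  mul_iso : Nonempty (carrier ≃* M)
  add_iso : Nonempty (Multiplicative carrier ≃* A)

attribute [instance] SkewBraceOver.skewBrace

/-- Isomorphism of skew braces. `B ≃+* C` is the type of bijections `B → C` that preserve
`+` and `*`; it presupposes no ring structure. -/
instance SkewBraceOver.isoSetoid (M A : Type u) [Group M] [Group A] :
    Setoid (SkewBraceOver M A) where
  r B C := Nonempty (B.carrier ≃+* C.carrier)
  iseqv :=
    { refl := fun B => ⟨RingEquiv.refl B.carrier⟩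
      symm := fun ⟨f⟩ => ⟨f.symm⟩
      trans := fun ⟨f⟩ ⟨h⟩ => ⟨f.trans h⟩ }

/-- The number `b(M,A)` of isomorphism classes of skew braces with multiplicative group isomorphic
to `M` and additive group isomorphic to `A`, as an element of `ℕ∞`. -/
noncomputable def skewBraceCount (M A : Type u) [Group M] [Group A] : ℕ∞ :=
  ENat.card (Quotient (SkewBraceOver.isoSetoid M A))

/-! By the Chinese remainder theorem `A` is a group of pairs `(x, r)`: `x` lies in the product of
the fields `ℤ/q` over the primes `q ∣ e`, and `r ∈ ℤ/d` acts through a faithful character `χ`. Its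
automorphisms are `(x, r) ↦ (s x + c (1 - χ r), r)`, so the left multiplications of a skew brace on
`A` are affine maps with parameters `α`, `m`, `β`, `j` (`exists_affine_of_skewBrace`). On the other
side, `M` is rewritten as `G(δζ, γ, κ)` with `ζ = gcd(κ - 1, ε)`. Then `κ - 1` is prime to `γ`, and
every character of `M` kills the generator `S` of order `γ`.

At each `q`, `α` and `β` are crossed homomorphisms `M → ℤ/q` for the characters `m` and `m χ(-j)`.
Transitivity forbids that both are coboundaries, and where `χ` is nontrivial exactly one of them is
(`exists_type`); where `χ` is trivial, `β = 0`. Let `f` be the set of `q` at which `β` is the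
nontrivial one. An automorphism of `A` removes the coboundary and scales the other crossed
homomorphism, and a change `T ↦ S ^ y * T` does the rest: the brace is determined by `f` and the
unit `j = r(T)` of `ℤ/d` (`exists_hasNormalForm`), and every such pair occurs
(`exists_skewBraceOver_hasNormalForm`).

The set `f` is an invariant, any subset of the primes dividing `g`; this gives `2 ^ ω(g)`. The unit
`j` changes only by factors `r ≡ 1` modulo `δ`, from `T ↦ T ^ r` (`HasNormalForm.unique`), so only
its image modulo `gcd(δ, d)` counts; this gives `w`. The condition `γ ∣ e` is necessary because the
affine description forces `S ^ e = 1`. -/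

/-! ### The additive group in coordinates, its affine maps and its automorphisms -/

/-- The group on pairs `(x, r)` with `x ∈ ∏ᵢ ℤ/pᵢ` and `r ∈ ℤ/d`, where `r` acts on the first
component through the character `χ`. It is written additively. -/
@[ext]
structure CharProduct {ι : Type} {p : ι → ℕ} {d : ℕ}
    (χ : AddChar (ZMod d) (∀ i, ZMod (p i))) where
  x : ∀ i, ZMod (p i)
  r : ZMod d

namespace CharProduct

variable {ι : Type} {p : ι → ℕ} {d : ℕ} {χ : AddChar (ZMod d) (∀ i, ZMod (p i))}

instance : Add (CharProduct χ) := ⟨fun a b => ⟨a.x + χ a.r * b.x, a.r + b.r⟩⟩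
instance : Zero (CharProduct χ) := ⟨⟨0, 0⟩⟩
instance : Neg (CharProduct χ) := ⟨fun a => ⟨-(χ (-a.r) * a.x), -a.r⟩⟩

@[simp] theorem add_x (a b : CharProduct χ) : (a + b).x = a.x + χ a.r * b.x := rfl
@[simp] theorem add_r (a b : CharProduct χ) : (a + b).r = a.r + b.r := rfl
@[simp] theorem zero_x : (0 : CharProduct χ).x = 0 := rfl
@[simp] theorem zero_r : (0 : CharProduct χ).r = 0 := rfl
@[simp] theorem neg_x (a : CharProduct χ) : (-a).x = -(χ (-a.r) * a.x) := rfl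
@[simp] theorem neg_r (a : CharProduct χ) : (-a).r = -a.r := rfl

instance : AddGroup (CharProduct χ) :=
  AddGroup.ofLeftAxioms
    (fun a b c => by
      ext1
      · simp only [add_x, add_r, AddChar.map_add_eq_mul]; ring
      · simp [add_assoc])
    (fun a => by ext1 <;> simp)
    (fun a => by ext1 <;> simp)

theorem nsmul_r (n : ℕ) (a : CharProduct χ) : (n • a).r = n • a.r := by
  induction n with
  | zero => simp
  | succ n ih => rw [succ_nsmul, succ_nsmul, add_r, ih]

theorem nsmul_mk_zero (n : ℕ) (x : ∀ i, ZMod (p i)) :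
    n • (⟨x, 0⟩ : CharProduct χ) = ⟨n • x, 0⟩ := by
  induction n with
  | zero => simp only [zero_smul]; rfl
  | succ n ih => rw [succ_nsmul, ih, succ_nsmul]; ext1 <;> simp

theorem nsmul_zero_mk (n : ℕ) (r : ZMod d) :
    n • (⟨0, r⟩ : CharProduct χ) = ⟨0, n • r⟩ := by
  induction n with
  | zero => simp only [zero_smul]; rfl
  | succ n ih => rw [succ_nsmul, ih, succ_nsmul]; ext1 <;> simp

/-- `CharProduct χ` is in bijection with the set of pairs. -/
def equivProd (χ : AddChar (ZMod d) (∀ i, ZMod (p i))) :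
    CharProduct χ ≃ (∀ i, ZMod (p i)) × ZMod d where
  toFun a := (a.x, a.r)
  invFun a := ⟨a.1, a.2⟩
  left_inv _ := rfl
  right_inv _ := rfl

/-- The affine map `(x, r) ↦ (α + m x + β χ(r + j), r + j)`. -/
def affine (χ : AddChar (ZMod d) (∀ i, ZMod (p i))) (α m β : ∀ i, ZMod (p i)) (j : ZMod d)
    (a : CharProduct χ) : CharProduct χ :=
  ⟨α + m * a.x + β * χ (a.r + j), a.r + j⟩

theorem chi_mul_neg (j : ZMod d) (i : ι) : χ j i * χ (-j) i = 1 := by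
  rw [← Pi.mul_apply, ← AddChar.map_add_eq_mul]; simp

/-- The four parameters compose separately: `α` is twisted by `m`, and `β` by `m χ(-j)`. The shift
in `χ (a.r + j)` is what makes `β` compose from the left, as `α` does. -/
theorem affine_affine (α m β α' m' β' : ∀ i, ZMod (p i)) (j j' : ZMod d) (a : CharProduct χ) :
    affine χ α m β j (affine χ α' m' β' j' a) =
      affine χ (α + m * α') (m * m') (β + m * χ (-j) * β') (j + j') a := by
  ext1
  · funext i
    have h := chi_mul_neg (χ := χ) j i
    simp only [affine, AddChar.map_add_eq_mul, Pi.add_apply, Pi.mul_apply]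
    linear_combination (-m i * β' i * χ a.r i * χ j' i) * h
  · simp only [affine]; ring

/-- This is the skew brace identity for a left multiplication, since `a = a * 0`. Hence a regular
group of affine maps yields a skew brace. -/
theorem affine_add (α m β : ∀ i, ZMod (p i)) (j : ZMod d) (a b : CharProduct χ) :
    affine χ α m β j (a + b) =
      affine χ α m β j a + -affine χ α m β j 0 + affine χ α m β j b := by
  ext1
  · funext i
    have h := chi_mul_neg (χ := χ) j i
    simp only [affine, AddChar.map_add_eq_mul, Pi.add_apply, Pi.mul_apply, add_x, add_r, neg_x,
      neg_r, zero_x, zero_r, zero_add, mul_zero, add_zero, Pi.neg_apply]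
    linear_combination (-α i * χ a.r i - m i * b.x i * χ a.r i - β i * χ b.r i * χ j i * χ a.r i
      + χ a.r i * (α i + β i * χ j i)) * h
  · simp only [affine, add_r, neg_r, zero_r]; ring

/-- The integers are dense in `∏ᵢ ℤ/pᵢ × ℤ/d`. -/
def HasLifts (p : ι → ℕ) (d : ℕ) : Prop :=
  ∀ (x : ∀ i, ZMod (p i)) (r : ZMod d), ∃ t : ℕ, (∀ i, (t : ZMod (p i)) = x i) ∧ (t : ZMod d) = r

theorem chi_ne_zero [∀ i, Fact (p i).Prime] (j : ZMod d) (i : ι) : χ j i ≠ 0 :=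
  left_ne_zero_of_mul_eq_one (chi_mul_neg j i)

theorem chi_eq_one_of_one [NeZero d] {i : ι} (h : χ 1 i = 1) (j : ZMod d) : χ j i = 1 := by
  rw [← ZMod.natCast_zmod_val j, ← nsmul_one, AddChar.map_nsmul_eq_pow, Pi.pow_apply, h, one_pow]

theorem chi_ne_one_of_isUnit [NeZero d] {i : ι} (h : χ 1 i ≠ 1) {j : ZMod d} (hj : IsUnit j) :
    χ j i ≠ 1 := by
  obtain ⟨v, hv⟩ := hj.exists_left_inv
  intro hji
  apply h
  rw [← hv, ← ZMod.natCast_zmod_val v, ← nsmul_eq_mul, AddChar.map_nsmul_eq_pow, Pi.pow_apply, hji,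
    one_pow]

/-- Description of the automorphisms of `CharProduct χ`. -/
theorem exists_of_addEquiv [NeZero d] [∀ i, Fact (p i).Prime] (hL : HasLifts p d)
    (hχ : ∀ r, χ r = 1 → r = 0) (θ : CharProduct χ ≃+ CharProduct χ) :
    ∃ s c : ∀ i, ZMod (p i), (∀ i, s i ≠ 0) ∧ (∀ i, χ 1 i = 1 → c i = 0) ∧
      ∀ a, θ a = ⟨s * a.x + c * (1 - χ a.r), a.r⟩ := by
  -- Multiplication by `t` is the identity on the first component and kills `ℤ/d`; it separates the
  -- two.
  obtain ⟨t, ht, ht0⟩ := hL 1 0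
  have hr : ∀ x, (θ ⟨x, 0⟩).r = 0 := by
    intro x
    have : t • (⟨x, 0⟩ : CharProduct χ) = ⟨x, 0⟩ := by
      rw [nsmul_mk_zero]; ext1
      · funext i; simp [ht i]
      · rfl
    rw [← this, map_nsmul, nsmul_r, nsmul_eq_mul, ht0, zero_mul]
  set s := (θ ⟨1, 0⟩).x with hs
  have hx : ∀ x, θ ⟨x, 0⟩ = ⟨s * x, 0⟩ := by
    intro x
    obtain ⟨n, hn, -⟩ := hL x 0
    have : (⟨x, 0⟩ : CharProduct χ) = n • ⟨1, 0⟩ := by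
      rw [nsmul_mk_zero]; ext1
      · funext i; simp [hn i]
      · rfl
    have h1 : θ ⟨1, 0⟩ = ⟨s, 0⟩ := by
      ext1
      · rfl
      · exact hr 1
    rw [this, map_nsmul, h1, nsmul_mk_zero]
    ext1
    · funext i; simp [hn i, mul_comm]
    · rfl
  have hs0 : ∀ i, s i ≠ 0 := by
    intro i hi
    classical
    have h : θ ⟨Pi.single i 1, 0⟩ = θ 0 := by
      rw [hx, map_zero]
      ext1
      · funext l
        by_cases hl : l = i
        · subst hl; simp [hi]
        · simp [hl]
      · rfl
    have h' := congrArg (fun a => a.x i) (θ.injective h)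
    simp at h'
  set c' : ZMod d → ∀ i, ZMod (p i) := fun r => (θ ⟨0, r⟩).x with hc'
  have hcomm : ∀ (r : ZMod d) (x : ∀ i, ZMod (p i)),
      (⟨0, r⟩ : CharProduct χ) + ⟨x, 0⟩ = ⟨χ r * x, 0⟩ + ⟨0, r⟩ := by
    intro r x; ext1 <;> simp
  -- Applying `θ` to the conjugation relation shows that `r` and its image act alike, and `χ` is
  -- faithful.
  have hθr : ∀ r, (θ ⟨0, r⟩).r = r := by
    intro r
    have h := congrArg θ (hcomm r 1)
    rw [map_add, map_add, hx, hx] at h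
    have h' := congrArg CharProduct.x h
    simp only [add_x, mul_one, AddChar.map_zero_eq_one, one_mul] at h'
    rw [add_comm, add_left_inj] at h'
    have h2 : χ ((θ ⟨0, r⟩).r) = χ r := by
      funext i
      have := congrFun h' i
      simp only [Pi.mul_apply] at this
      rw [mul_comm] at this
      exact mul_left_cancel₀ (hs0 i) this
    have h3 := hχ ((θ ⟨0, r⟩).r + -r) (by
      rw [AddChar.map_add_eq_mul, h2, ← AddChar.map_add_eq_mul]; simp)
    linear_combination h3
  have hcoc : ∀ r r', c' (r + r') = c' r + χ r * c' r' := by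
    intro r r'
    have : (⟨0, r + r'⟩ : CharProduct χ) = ⟨0, r⟩ + ⟨0, r'⟩ := by ext1 <;> simp
    simp only [hc', this, map_add, add_x, hθr]
  -- Where `χ` is trivial, the cocycle is a homomorphism from `ℤ/d` to `ℤ/pᵢ`, and `t` shows that it
  -- vanishes.
  have hc0 : ∀ i, χ 1 i = 1 → ∀ r, c' r i = 0 := by
    intro i hi r
    have hm : ∀ n : ℕ, c' (n • r) i = n • c' r i := by
      intro n
      induction n with
      | zero =>
        have h0 := congrFun (hcoc 0 0) i
        simp only [add_zero, AddChar.map_zero_eq_one, one_mul, Pi.add_apply] at h0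
        simpa using h0
      | succ n ih =>
        rw [succ_nsmul, hcoc, Pi.add_apply, Pi.mul_apply, chi_eq_one_of_one hi, one_mul, ih,
          succ_nsmul]
    have h1 := hm t
    have h0 := hm 0
    rw [nsmul_eq_mul, ht0, zero_mul, nsmul_eq_mul, ht i] at h1
    simp only [zero_smul] at h0
    simpa [h0] using h1.symm
  -- Elsewhere the cocycle is a coboundary: expand both `c' (1 + r)` and `c' (r + 1)` and compare.
  refine ⟨s, fun i => if χ 1 i = 1 then 0 else c' 1 i / (1 - χ 1 i), hs0, ?_, ?_⟩
  · intro i hi; simp [hi]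
  · intro a
    have : a = ⟨a.x, 0⟩ + ⟨0, a.r⟩ := by ext1 <;> simp
    rw [this, map_add, hx]
    ext1
    · funext i
      have h1 := congrFun (hcoc 1 a.r) i
      have h2 := congrFun (hcoc a.r 1) i
      rw [add_comm] at h1
      have h3 := hc0 i
      simp only [add_x, AddChar.map_zero_eq_one, one_mul, Pi.add_apply, Pi.mul_apply, mul_zero,
        add_zero, add_r, zero_add, Pi.sub_apply, Pi.one_apply] at h1 h2 ⊢
      change _ + c' a.r i = _
      split_ifs with hi
      · rw [h3 hi]; ring
      · have : (1 : ZMod (p i)) - χ 1 i ≠ 0 := sub_ne_zero.2 (Ne.symm hi)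
        field_simp
        linear_combination h1 - h2
    · simp [hθr]

end CharProduct

/-! ### The lambda map of a skew brace -/

namespace SkewBrace

variable {B : Type*} [SkewBrace B]

theorem mul_zero_eq (a : B) : a * 0 = a := by
  have h := mul_add_skew a 0 0
  rw [add_zero, add_assoc] at h
  have h' := left_eq_add.1 h
  exact (neg_add_eq_zero.1 h').symm

theorem one_eq_zero : (1 : B) = 0 := by
  rw [← mul_zero_eq (1 : B), one_mul]

/-- The automorphism `b ↦ -a + a * b` of the additive group. -/
def lambda (a : B) : B ≃+ B where
  toFun b := -a + a * b
  invFun b := a⁻¹ * (a + b)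
  left_inv b := by simp
  right_inv b := by simp
  map_add' b c := by rw [mul_add_skew]; simp only [add_assoc]

theorem lambda_apply (a b : B) : lambda a b = -a + a * b := rfl

end SkewBrace

/-! ### Left multiplications as affine maps -/

namespace CharProduct

variable {ι : Type} {p : ι → ℕ} {d : ℕ} {χ : AddChar (ZMod d) (∀ i, ZMod (p i))}

/-- Left multiplications of a skew brace with additive group `CharProduct χ` are affine. -/
theorem exists_affine_of_skewBrace [NeZero d] [∀ i, Fact (p i).Prime] (hL : HasLifts p d)
    (hχ : ∀ r, χ r = 1 → r = 0) {B : Type*} [SkewBrace B] (π : B ≃+ CharProduct χ) (b : B) :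
    ∃ α m β : ∀ i, ZMod (p i), (∀ i, m i ≠ 0) ∧ (∀ i, χ 1 i = 1 → β i = 0) ∧
      ∀ c, π (b * c) = affine χ α m β (π b).r (π c) := by
  obtain ⟨s, c, hs, hc, h⟩ := exists_of_addEquiv hL hχ
    ((π.symm.trans (SkewBrace.lambda b)).trans π)
  -- Left multiplication by `b` is `lambda b` followed by the translation by `b`; the parameters
  -- come from expanding this.
  refine ⟨(π b).x + χ (π b).r * c, χ (π b).r * s, -c,
    fun i => mul_ne_zero (chi_ne_zero _ i) (hs i), fun i hi => by simp [hc i hi], fun b' => ?_⟩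
  have h1 := h (π b')
  simp only [AddEquiv.trans_apply, AddEquiv.symm_apply_apply, SkewBrace.lambda_apply, map_add,
    map_neg] at h1
  rw [neg_add_eq_iff_eq_add] at h1
  rw [h1]
  ext1
  · simp only [affine, add_x, AddChar.map_add_eq_mul]; ring
  · simp only [affine, add_r]; ring

/-- The values at `0`, `(1, 0)` and `(0, 1)` determine the parameters. Where `χ` is trivial, only `α
+ β` is visible, whence the normalisation `β = 0` there. -/
theorem affine_inj [∀ i, Fact (p i).Prime] {α m β α' m' β' : ∀ i, ZMod (p i)} {j j' : ZMod d}
    (hβ : ∀ i, χ 1 i = 1 → β i = 0) (hβ' : ∀ i, χ 1 i = 1 → β' i = 0)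
    (h : ∀ a, affine χ α m β j a = affine χ α' m' β' j' a) :
    α = α' ∧ m = m' ∧ β = β' ∧ j = j' := by
  have hj : j = j' := by simpa [affine] using congrArg CharProduct.r (h 0)
  subst hj
  have key : ∀ i, α i = α' i ∧ m i = m' i ∧ β i = β' i := by
    intro i
    have h0 := congrFun (congrArg CharProduct.x (h 0)) i
    have h1 := congrFun (congrArg CharProduct.x (h ⟨1, 0⟩)) i
    have h2 := congrFun (congrArg CharProduct.x (h ⟨0, 1⟩)) i
    simp only [affine, zero_x, zero_r, Pi.add_apply, Pi.mul_apply, mul_zero, add_zero, zero_add,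
      mul_one, AddChar.map_add_eq_mul] at h0 h1 h2
    have hb : β i = β' i := by
      by_cases hi : χ 1 i = 1
      · rw [hβ i hi, hβ' i hi]
      · have h3 : (β i - β' i) * ((χ 1 i - 1) * χ j i) = 0 := by linear_combination h2 - h0
        rcases mul_eq_zero.1 h3 with h3 | h3
        · exact sub_eq_zero.1 h3
        · exact absurd h3 (mul_ne_zero (sub_ne_zero.2 hi) (chi_ne_zero j i))
    rw [hb] at h0 h1
    exact ⟨by linear_combination h0, by linear_combination h1 - h0, hb⟩
  exact ⟨funext fun i => (key i).1, funext fun i => (key i).2.1, funext fun i => (key i).2.2, rfl⟩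

/-- How affine maps change under an automorphism of `CharProduct χ`. -/
theorem affine_conj [∀ i, Fact (p i).Prime] {α m β α' m' β' s c : ∀ i, ZMod (p i)} {j j' : ZMod d}
    (hs : ∀ i, s i ≠ 0)
    (h : ∀ a : CharProduct χ, affine χ α' m' β' j' ⟨s * a.x + c * (1 - χ a.r), a.r⟩ =
      ⟨s * (affine χ α m β j a).x + c * (1 - χ (affine χ α m β j a).r),
        (affine χ α m β j a).r⟩) :
    j' = j ∧ m' = m ∧ ∀ i, χ 1 i ≠ 1 → α' i = s i * α i + (1 - m i) * c i ∧
      β' i = s i * β i - (1 - m i * χ (-j) i) * c i := by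
  have hj : j' = j := by simpa [affine] using congrArg CharProduct.r (h 0)
  subst hj
  have key : ∀ i, m' i = m i ∧ (χ 1 i ≠ 1 → α' i = s i * α i + (1 - m i) * c i ∧
      β' i = s i * β i - (1 - m i * χ (-j') i) * c i) := by
    intro i
    have h0 := congrFun (congrArg CharProduct.x (h 0)) i
    have h1 := congrFun (congrArg CharProduct.x (h ⟨1, 0⟩)) i
    have h2 := congrFun (congrArg CharProduct.x (h ⟨0, 1⟩)) i
    simp only [affine, zero_x, zero_r, Pi.add_apply, Pi.mul_apply, mul_zero, add_zero, zero_add,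
      Pi.one_apply, mul_one, AddChar.map_add_eq_mul, AddChar.map_zero_eq_one, sub_self,
      Pi.sub_apply] at h0 h1 h2
    have hm : m' i = m i := mul_left_cancel₀ (hs i) (by linear_combination h1 - h0)
    refine ⟨hm, fun hi => ?_⟩
    have hinv := chi_mul_neg (χ := χ) j' i
    rw [hm] at h2
    have hb : β' i = s i * β i - (1 - m i * χ (-j') i) * c i := by
      have h3 : ((χ 1 i - 1) * χ j' i) * (β' i - (s i * β i - (1 - m i * χ (-j') i) * c i)) = 0 := by
        linear_combination h2 - h0 - (χ 1 i - 1) * m i * c i * hinv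
      rcases mul_eq_zero.1 h3 with h3 | h3
      · exact absurd h3 (mul_ne_zero (sub_ne_zero.2 hi) (chi_ne_zero j' i))
      · exact sub_eq_zero.1 h3
    refine ⟨?_, hb⟩
    rw [hb] at h0
    linear_combination h0 - m i * c i * hinv
  exact ⟨rfl, funext fun i => (key i).1, fun i => (key i).2⟩

/-! ### Normal forms and their invariants -/

variable [DecidableEq ι]

/-- The affine maps of the standard regular subgroup: `Γ` is the set of places where the
commutator subgroup acts nontrivially, `f` the set of places of the second type. -/
def std (χ : AddChar (ZMod d) (∀ i, ZMod (p i))) (Γ : Finset ι) (κ : ℕ) (f : Finset ι)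
    (j : ZMod d) (y t : ℕ) : CharProduct χ → CharProduct χ :=
  -- The factor `χ (t • j)` in `m` at places of `f` makes the character `m χ(-j)` of `β` there equal
  -- to what `m` is outside `f`.
  affine χ (fun i => if i ∈ f then 0 else if i ∈ Γ then (y : ZMod (p i)) else t)
    (fun i => (if i ∈ Γ then (κ : ZMod (p i)) ^ t else 1) * if i ∈ f then χ (t • j) i else 1)
    (fun i => if i ∈ f then if i ∈ Γ then (y : ZMod (p i)) else t else 0) (t • j)

variable {Γ : Finset ι} {κ : ℕ} {f : Finset ι} {j : ZMod d}

theorem std_zero (a : CharProduct χ) : std χ Γ κ f j 0 0 a = a := by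
  ext1
  · funext i; simp [std, affine]
  · simp [std, affine]

/-- This is the multiplication rule of the words `S ^ y * T ^ t` when `T * S = S ^ κ * T`; natural
exponents avoid any reduction modulo the orders. -/
theorem std_std (y t y' t' : ℕ) (a : CharProduct χ) :
    std χ Γ κ f j y t (std χ Γ κ f j y' t' a) =
      std χ Γ κ f j (y + κ ^ t * y') (t + t') a := by
  rw [std, std, affine_affine, std, ← add_smul]
  have h := fun i => chi_mul_neg (χ := χ) (t • j) i
  congr 1
  · funext i
    by_cases hf : i ∈ f <;> by_cases hΓ : i ∈ Γ <;> simp [hf, hΓ]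
  · funext i
    by_cases hf : i ∈ f <;> by_cases hΓ : i ∈ Γ <;>
      simp [hf, hΓ, pow_add, add_mul, AddChar.map_add_eq_mul]
    ring
  · funext i
    by_cases hf : i ∈ f <;> by_cases hΓ : i ∈ Γ <;> simp [hf, hΓ]
    · have := h i
      simp only [nsmul_eq_mul] at this
      linear_combination ((κ : ZMod (p i)) ^ t * y') * this
    · have := h i
      simp only [nsmul_eq_mul] at this
      linear_combination (t' : ZMod (p i)) * this

/-- A skew brace in normal form: in suitable coordinates of the additive group, the multiplicative
group is generated by two elements that act by `std`. -/
def HasNormalForm (χ : AddChar (ZMod d) (∀ i, ZMod (p i))) (Γ : Finset ι) (κ : ℕ) (f : Finset ι)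
    (j : ZMod d) (B : Type*) [SkewBrace B] : Prop :=
  ∃ (π : B ≃+ CharProduct χ) (S T : B), (∀ b, ∃ y t : ℕ, b = S ^ y * T ^ t) ∧
    (∀ b, π (S * b) = std χ Γ κ f j 1 0 (π b)) ∧ ∀ b, π (T * b) = std χ Γ κ f j 0 1 (π b)

/-- The map `π` is an arbitrary function, so that this also applies to permutations evaluated at a
point. -/
theorem std_pow_mul {B : Type*} [Group B] {π : B → CharProduct χ} {S T : B}
    (hS : ∀ b, π (S * b) = std χ Γ κ f j 1 0 (π b))
    (hT : ∀ b, π (T * b) = std χ Γ κ f j 0 1 (π b)) (y t : ℕ) (b : B) :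
    π (S ^ y * T ^ t * b) = std χ Γ κ f j y t (π b) := by
  have hSy : ∀ b, π (S ^ y * b) = std χ Γ κ f j y 0 (π b) := by
    induction y with
    | zero => intro b; rw [std_zero, pow_zero, one_mul]
    | succ y ih => intro b; rw [pow_succ, mul_assoc, ih, hS, std_std]; simp
  have hTt : ∀ b, π (T ^ t * b) = std χ Γ κ f j 0 t (π b) := by
    induction t with
    | zero => intro b; rw [std_zero, pow_zero, one_mul]
    | succ t ih => intro b; rw [pow_succ, mul_assoc, ih, hT, std_std]; simp
  rw [mul_assoc, hSy, hTt, std_std]; simp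

/-- Skew braces with the same normal form are isomorphic. -/
theorem HasNormalForm.nonempty_ringEquiv {B C : Type*} [SkewBrace B] [SkewBrace C]
    (hB : HasNormalForm χ Γ κ f j B) (hC : HasNormalForm χ Γ κ f j C) : Nonempty (B ≃+* C) := by
  obtain ⟨π, S, T, hgen, hS, hT⟩ := hB
  obtain ⟨π', S', T', -, hS', hT'⟩ := hC
  -- `θ` is additive and intertwines the two generating pairs. As it fixes `1 = 0`, evaluation at
  -- `1` makes it multiplicative.
  set θ := π.trans π'.symm with hθ
  have h1 : θ 1 = 1 := by rw [SkewBrace.one_eq_zero, map_zero, SkewBrace.one_eq_zero]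
  have key : ∀ y t : ℕ, ∀ c, θ (S ^ y * T ^ t * c) = S' ^ y * T' ^ t * θ c := by
    intro y t c
    apply π'.injective
    rw [std_pow_mul hS' hT']
    simp only [hθ, AddEquiv.trans_apply, AddEquiv.apply_symm_apply]
    rw [std_pow_mul hS hT]
  exact ⟨{ θ with
    map_mul' := fun b c => by
      obtain ⟨y, t, rfl⟩ := hgen b
      change θ _ = θ _ * θ _
      rw [key, ← mul_one (S ^ y * T ^ t), key, h1, mul_one] }⟩

theorem HasNormalForm.congr {B C : Type*} [SkewBrace B] [SkewBrace C]
    (hB : HasNormalForm χ Γ κ f j B) (θ : C ≃+* B) : HasNormalForm χ Γ κ f j C := by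
  obtain ⟨π, S, T, hgen, hS, hT⟩ := hB
  refine ⟨θ.toAddEquiv.trans π, θ.symm S, θ.symm T, fun c => ?_, fun c => ?_, fun c => ?_⟩
  · obtain ⟨y, t, h⟩ := hgen (θ c)
    refine ⟨y, t, θ.injective ?_⟩
    have hp : ∀ (c : C) (y : ℕ), θ (c ^ y) = θ c ^ y := fun c y => map_pow θ.toMulEquiv c y
    rw [h, map_mul, hp, hp]; simp
  · simpa using hS (θ c)
  · simpa using hT (θ c)

/-- The invariants in a normal form are determined by the skew brace. -/
theorem HasNormalForm.unique [NeZero d] [∀ i, Fact (p i).Prime] (hL : HasLifts p d)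
    (hχ : ∀ r, χ r = 1 → r = 0) {f' : Finset ι} {j' : ZMod d}
    (hf : ∀ i ∈ f, χ 1 i ≠ 1)
    (hf' : ∀ i ∈ f', χ 1 i ≠ 1) (hj' : IsUnit j') {B : Type*} [SkewBrace B]
    (hB : HasNormalForm χ Γ κ f j B) (hB' : HasNormalForm χ Γ κ f' j' B) :
    f = f' ∧ ∃ r : ℕ, (∀ i ∈ Γ, (κ : ZMod (p i)) ^ r = κ) ∧ j' = r • j := by
  obtain ⟨π, S, T, hgen, hS, hT⟩ := hB
  obtain ⟨π', S', T', -, hS', hT'⟩ := hB'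
  obtain ⟨s, c, hs, -, hsc⟩ := exists_of_addEquiv hL hχ (π.symm.trans π')
  have hθ : ∀ b, π' b = ⟨s * (π b).x + c * (1 - χ (π b).r), (π b).r⟩ := fun b => by
    simpa using hsc (π b)
  obtain ⟨y, t, hyt⟩ := hgen S'
  obtain ⟨y', r, hyr⟩ := hgen T'
  have eS := affine_conj (χ := χ) (c := c) hs (fun a => by
    have h := hS' (π.symm a)
    rw [hyt, hθ, hθ, std_pow_mul hS hT] at h
    simpa only [AddEquiv.apply_symm_apply, std] using h.symm)
  have eT := affine_conj (χ := χ) (c := c) hs (fun a => by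
    have h := hT' (π.symm a)
    rw [hyr, hθ, hθ, std_pow_mul hS hT] at h
    simpa only [AddEquiv.apply_symm_apply, std] using h.symm)
  obtain ⟨eS1, eS2, eS3⟩ := eS
  obtain ⟨eT1, eT2, -⟩ := eT
  rw [one_smul] at eT1
  -- In `Γ`, the multiplier of `S'` is `1`, so conjugation only scales its `α` and `β`, and `f`
  -- shows in which of them vanishes. Outside `Γ`, the multiplier of `T'` is `χ j' ≠ 1` on `f'` and
  -- `1` off it.
  have hff : ∀ i, χ 1 i ≠ 1 → (i ∈ f ↔ i ∈ f') := by
    intro i hi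
    by_cases hΓ : i ∈ Γ
    · have h2 := congrFun eS2 i
      obtain ⟨h3, h4⟩ := eS3 i hi
      rw [← h2, ← eS1] at h4
      rw [← h2] at h3
      by_cases h : i ∈ f <;> by_cases h' : i ∈ f' <;> simp [h, h', hΓ] at h3 h4 ⊢
    · have h2 := congrFun eT2 i
      rw [← eT1] at h2
      have := chi_ne_one_of_isUnit hi hj'
      by_cases h : i ∈ f <;> by_cases h' : i ∈ f' <;> simp [h, h', hΓ] at h2 ⊢
      · exact this h2.symm
      · exact this h2
  have hfe : f = f' := by
    ext i
    by_cases hi : χ 1 i = 1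
    · exact ⟨fun h => absurd hi (hf i h), fun h => absurd hi (hf' i h)⟩
    · exact hff i hi
  refine ⟨hfe, r, fun i hΓ => ?_, eT1⟩
  have h2 := congrFun eT2 i
  rw [← eT1, ← hfe] at h2
  by_cases h : i ∈ f <;> simp [h, hΓ] at h2
  · rcases h2 with h2 | h2
    · exact h2.symm
    · exact absurd h2 (chi_ne_zero _ _)
  · exact h2.symm

end CharProduct

/-! ### Crossed homomorphisms on metacyclic groups -/

section Crossed

variable {B F : Type*} [Group B] [Field F]

theorem pow_mul_pow_of_mul_eq {S T : B} {κ : ℕ} (h : T * S = S ^ κ * T) (y t : ℕ) :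
    T ^ t * S ^ y = S ^ (κ ^ t * y) * T ^ t := by
  have h1 : ∀ y : ℕ, T * S ^ y = S ^ (κ * y) * T := by
    intro y
    induction y with
    | zero => simp
    | succ y ih => rw [pow_succ, ← mul_assoc, ih, mul_assoc, h, ← mul_assoc, ← pow_add, mul_add_one]
  induction t generalizing y with
  | zero => simp
  | succ t ih => rw [pow_succ, mul_assoc, h1, ← mul_assoc, ih, mul_assoc, pow_succ, mul_assoc]

/-- If a group is generated by `S`, `T` with `T S T⁻¹ = S ^ κ`, then a crossed homomorphism into a
field either is nontrivial on the expected generator, or is a coboundary. -/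
theorem crossedHom_dichotomy {u μ : B → F} (hu : ∀ a b, u (a * b) = u a + μ a * u b)
    (hμ : ∀ a b, μ (a * b) = μ a * μ b) (hμ0 : ∀ a, μ a ≠ 0) {S T : B} {γ N κ : ℕ}
    (hgen : ∀ b, ∃ y t : ℕ, b = S ^ y * T ^ t) (hS : S ^ γ = 1) (hT : T ^ N = 1)
    (hrel : T * S = S ^ κ * T) (hμS : μ S = 1) {P : Prop} [Decidable P] (hP : P ↔ (γ : F) = 0)
    (hN : P → (N : F) ≠ 0) :
    (μ T = (if P then (κ : F) else 1) ∧ u (if P then S else T) ≠ 0 ∧ (¬ P → u S = 0)) ∨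
      ∃ u₀, ∀ b, u b = (1 - μ b) * u₀ := by
  have hμ1 : μ 1 = 1 := by
    have := hμ 1 1
    rw [mul_one] at this
    exact (mul_eq_left₀ (hμ0 1)).1 this.symm
  have hu1 : u 1 = 0 := by
    have := hu 1 1
    rw [mul_one, hμ1, one_mul] at this
    exact left_eq_add.1 this
  have hμSy : ∀ y : ℕ, μ (S ^ y) = 1 := by
    intro y
    induction y with
    | zero => simpa using hμ1
    | succ y ih => rw [pow_succ, hμ, ih, hμS, one_mul]
  have huSy : ∀ y : ℕ, u (S ^ y) = y * u S := by
    intro y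
    induction y with
    | zero => simpa using hu1
    | succ y ih => rw [pow_succ, hu, ih, hμSy]; push_cast; ring
  -- As `μ S = 1`, `u` is linear on powers of `S`; the relation then forces `μ T = κ` unless `u S =
  -- 0`.
  have hrel' : (μ T - κ) * u S = 0 := by
    have h := congrArg u hrel
    rw [hu, hu, hμSy, huSy] at h
    linear_combination h
  have hγ : (γ : F) * u S = 0 := by rw [← huSy, hS, hu1]
  have hnP : ¬ P → u S = 0 := fun h => by
    rcases mul_eq_zero.1 hγ with h' | h'
    · exact absurd (hP.2 h') h
    · exact h'
  have hcob : u S = 0 → ∀ u₀, u T = (1 - μ T) * u₀ → ∀ b, u b = (1 - μ b) * u₀ := by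
    intro h0 u₀ hT₀ b
    obtain ⟨y, t, rfl⟩ := hgen b
    have ht : u (T ^ t) = (1 - μ (T ^ t)) * u₀ := by
      induction t with
      | zero => simp [hu1, hμ1]
      | succ t ih => rw [pow_succ, hu, hμ, ih, hT₀]; ring
    rw [hu, hμ, huSy, hμSy, h0, ht]; ring
  by_cases hgood : μ T = (if P then (κ : F) else 1) ∧ u (if P then S else T) ≠ 0
  · exact Or.inl ⟨hgood.1, hgood.2, hnP⟩
  · right
    have huS : u S = 0 := by
      by_cases h : P
      · rw [if_pos h, if_pos h] at hgood
        by_contra h0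
        exact hgood ⟨sub_eq_zero.1 ((mul_eq_zero.1 hrel').resolve_right h0), h0⟩
      · exact hnP h
    -- With `u S = 0`, only `u T` is left. If `μ T = 1`, then `u T` vanishes, in case `P` because `N
    -- * u T = 0`; otherwise dividing by `1 - μ T` gives `u₀`.
    by_cases h1 : μ T = 1
    · have hT0 : u T = 0 := by
        by_cases h : P
        · have hTt : ∀ t : ℕ, u (T ^ t) = t * u T := by
            intro t
            induction t with
            | zero => simpa using hu1
            | succ t ih => rw [pow_succ', hu, ih, h1]; push_cast; ring
          have := hTt N
          rw [hT, hu1] at this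
          exact (mul_eq_zero.1 this.symm).resolve_left (hN h)
        · rw [if_neg h, if_neg h] at hgood
          by_contra h0
          exact hgood ⟨h1, h0⟩
      exact ⟨0, hcob huS 0 (by rw [hT0, mul_zero])⟩
    · have h2 : 1 - μ T ≠ 0 := sub_ne_zero.2 (Ne.symm h1)
      exact ⟨u T / (1 - μ T), hcob huS _ (by field_simp)⟩

end Crossed

/-! ### Reduction of a skew brace to normal form -/

namespace CharProduct

variable {ι : Type} {p : ι → ℕ} {d : ℕ} {χ : AddChar (ZMod d) (∀ i, ZMod (p i))}

/-- The automorphism `(x, r) ↦ (s x + c (1 - χ r), r)`. -/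
def shear [∀ i, Fact (p i).Prime] (χ : AddChar (ZMod d) (∀ i, ZMod (p i)))
    (s c : ∀ i, ZMod (p i)) (hs : ∀ i, s i ≠ 0) : CharProduct χ ≃+ CharProduct χ where
  toFun a := ⟨s * a.x + c * (1 - χ a.r), a.r⟩
  invFun a := ⟨s⁻¹ * (a.x - c * (1 - χ a.r)), a.r⟩
  left_inv a := by
    ext1
    · funext i
      have := hs i
      simp only [Pi.mul_apply, Pi.inv_apply, Pi.sub_apply, Pi.add_apply]
      field_simp
      ring
    · rfl
  right_inv a := by
    ext1
    · funext i
      have := hs i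
      simp only [Pi.mul_apply, Pi.inv_apply, Pi.sub_apply, Pi.add_apply]
      field_simp
      ring
    · rfl
  map_add' a b := by
    ext1
    · simp only [add_x, add_r, AddChar.map_add_eq_mul]; ring
    · rfl

/-- Conjugation by a shear scales `α` and `β` by `s` and changes them by coboundaries with opposite
constants `c` and `-c`. -/
theorem shear_affine [∀ i, Fact (p i).Prime] {s c : ∀ i, ZMod (p i)} (hs : ∀ i, s i ≠ 0)
    (α m β : ∀ i, ZMod (p i)) (j : ZMod d) (a : CharProduct χ) :
    shear χ s c hs (affine χ α m β j a) =
      affine χ (s * α + (1 - m) * c) m (s * β - (1 - m * χ (-j)) * c) j (shear χ s c hs a) := by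
  ext1
  · funext i
    have h := chi_mul_neg (χ := χ) j i
    simp only [shear, affine, AddEquiv.coe_mk, Equiv.coe_fn_mk, Pi.mul_apply, Pi.sub_apply,
      Pi.add_apply, Pi.one_apply, AddChar.map_add_eq_mul]
    linear_combination (-m i * c i * χ a.r i) * h
  · rfl

/-- The coordinates of the left multiplications of a skew brace with additive group
`CharProduct χ` are characters and crossed homomorphisms. -/
theorem exists_crossedHoms [NeZero d] [∀ i, Fact (p i).Prime] (hL : HasLifts p d)
    (hχ : ∀ r, χ r = 1 → r = 0) {B : Type*} [SkewBrace B] (π : B ≃+ CharProduct χ) :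
    ∃ α m β : B → ∀ i, ZMod (p i), (∀ b i, m b i ≠ 0) ∧ (∀ b i, χ 1 i = 1 → β b i = 0) ∧
      (∀ b c, π (b * c) = affine χ (α b) (m b) (β b) (π b).r (π c)) ∧
      (∀ b b', α (b * b') = α b + m b * α b') ∧ (∀ b b', m (b * b') = m b * m b') ∧
      ∀ b b', β (b * b') = β b + m b * χ (-(π b).r) * β b' := by
  choose α m β hm hβ haff using exists_affine_of_skewBrace hL hχ π
  have hcomp : ∀ b b', α (b * b') = α b + m b * α b' ∧ m (b * b') = m b * m b' ∧
      β (b * b') = β b + m b * χ (-(π b).r) * β b' ∧ (π (b * b')).r = (π b).r + (π b').r := by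
    intro b b'
    apply affine_inj (χ := χ) (hβ _)
    · intro i hi
      simp [hβ b i hi, hβ b' i hi]
    · intro a
      have h1 := haff (b * b') (π.symm a)
      rw [mul_assoc, haff b, haff b', affine_affine, AddEquiv.apply_symm_apply] at h1
      exact h1.symm
  exact ⟨α, m, β, hm, hβ, haff, fun b b' => (hcomp b b').1, fun b b' => (hcomp b b').2.1,
    fun b b' => (hcomp b b').2.2.1⟩

section SkewBrace

variable [NeZero d] [∀ i, Fact (p i).Prime] {B : Type*} [SkewBrace B]

theorem r_mul (hL : HasLifts p d) (hχ : ∀ r, χ r = 1 → r = 0) (π : B ≃+ CharProduct χ) (b b' : B) :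
    (π (b * b')).r = (π b).r + (π b').r := by
  obtain ⟨α, m, β, -, -, h⟩ := exists_affine_of_skewBrace hL hχ π b
  rw [h, add_comm]; rfl

theorem r_pow (hL : HasLifts p d) (hχ : ∀ r, χ r = 1 → r = 0) (π : B ≃+ CharProduct χ) (b : B)
    (n : ℕ) : (π (b ^ n)).r = n • (π b).r := by
  induction n with
  | zero => rw [pow_zero, SkewBrace.one_eq_zero, map_zero, zero_smul, zero_r]
  | succ n ih => rw [pow_succ, r_mul hL hχ, ih, succ_nsmul]

variable {S T : B} {γ κ : ℕ}

/-- The component `r` is a homomorphism from the multiplicative group to an abelian group, so both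
`κ - 1` and `γ` kill `r(S)`. -/
theorem r_eq_zero_of_mul_eq (hL : HasLifts p d) (hχ : ∀ r, χ r = 1 → r = 0)
    (π : B ≃+ CharProduct χ) (hS : S ^ γ = 1) (hrel : T * S = S ^ κ * T)
    (hκ : IsCoprime ((κ : ℤ) - 1) γ) : (π S).r = 0 := by
  obtain ⟨v, w, hvw⟩ := hκ
  have h1 : (κ : ZMod d) * (π S).r = (π S).r := by
    have h := congrArg (fun b => (π b).r) hrel
    simp only [r_mul hL hχ, r_pow hL hχ, nsmul_eq_mul] at h
    linear_combination -h
  have h2 : (γ : ZMod d) * (π S).r = 0 := by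
    rw [← nsmul_eq_mul, ← r_pow hL hχ, hS, SkewBrace.one_eq_zero, map_zero, zero_r]
  have h3 := congrArg (Int.cast : ℤ → ZMod d) hvw
  push_cast at h3
  linear_combination (v : ZMod d) * h1 + (w : ZMod d) * h2 - (π S).r * h3

end SkewBrace

/-- The same argument for a character: the order of `m S` divides both `κ - 1` and `γ`. -/
theorem eq_one_of_mul_eq {B F : Type*} [Group B] [Field F] {m : B → F} {S T : B} {γ κ : ℕ}
    (hm0 : ∀ b, m b ≠ 0) (hm : ∀ a b, m (a * b) = m a * m b) (hS : S ^ γ = 1)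
    (hrel : T * S = S ^ κ * T) (hκ : IsCoprime ((κ : ℤ) - 1) γ) : m S = 1 := by
  obtain ⟨v, w, hvw⟩ := hκ
  have hm1 : m 1 = 1 := by
    have := hm 1 1
    rw [mul_one] at this
    exact (mul_eq_left₀ (hm0 1)).1 this.symm
  have hmpow : ∀ n : ℕ, m (S ^ n) = m S ^ n := by
    intro n
    induction n with
    | zero => simpa using hm1
    | succ n ih => rw [pow_succ, hm, ih, pow_succ]
  have h1 : m S ^ κ = m S := by
    have h := congrArg m hrel
    rw [hm, hm, hmpow, mul_comm] at h
    exact (mul_right_cancel₀ (hm0 T) h).symm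
  have h2 : m S ^ γ = 1 := by rw [← hmpow, hS, hm1]
  have h3 : m S ^ ((κ : ℤ) - 1) = 1 := by
    rw [zpow_sub₀ (hm0 S), zpow_natCast, h1, zpow_one, div_self (hm0 S)]
  rw [← zpow_one (m S), ← hvw, zpow_add₀ (hm0 S), mul_comm v, mul_comm w, zpow_mul, zpow_mul,
    h3, zpow_natCast, h2, one_zpow, one_zpow, one_mul]

theorem crossedHom_pow {B F : Type*} [Group B] [Field F] {u μ : B → F} {S : B}
    (hu : ∀ a b, u (a * b) = u a + μ a * u b) (hμS : μ S = 1) (y : ℕ) :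
    u (S ^ y) = y * u S := by
  have hu1 : u 1 = 0 := by
    have h1 := hu S 1
    rw [mul_one, hμS, one_mul] at h1
    exact left_eq_add.1 h1
  induction y with
  | zero => simpa using hu1
  | succ y ih => rw [pow_succ', hu, ih, hμS]; push_cast; ring

/-- A commutator that is killed by `γ` is killed by the exponent of `∏ᵢ ℤ/pᵢ`. -/
theorem pow_eq_one_of_skewBrace [NeZero d] [∀ i, Fact (p i).Prime] (hL : HasLifts p d)
    (hχ : ∀ r, χ r = 1 → r = 0) {B : Type*} [SkewBrace B] (π : B ≃+ CharProduct χ) {S T : B}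
    {γ κ : ℕ} (hS : S ^ γ = 1) (hrel : T * S = S ^ κ * T) (hκ : IsCoprime ((κ : ℤ) - 1) γ)
    {e : ℕ} (he : ∀ i, (e : ZMod (p i)) = 0) : S ^ e = 1 := by
  obtain ⟨α, m, β, hm, -, haff, hα, hmm, hβ⟩ := exists_crossedHoms hL hχ π
  have hrS := r_eq_zero_of_mul_eq hL hχ π hS hrel hκ
  have hmS : ∀ i, m S i = 1 := fun i =>
    eq_one_of_mul_eq (m := fun b => m b i) (fun b => hm b i) (fun a b => by simp [hmm]) hS hrel hκ
  -- An element is recovered from its affine map at `π 1 = 0`. Both `α` and `β` are linear on powers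
  -- of `S`, so they vanish at `S ^ e`.
  apply π.injective
  have h := haff (S ^ e) 1
  rw [mul_one] at h
  rw [h, SkewBrace.one_eq_zero, map_zero]
  ext1
  · funext i
    have h1 := crossedHom_pow (u := fun b => α b i) (μ := fun b => m b i)
      (fun a b => by simp [hα]) (hmS i) e
    have h2 := crossedHom_pow (u := fun b => β b i) (μ := fun b => m b i * χ (-(π b).r) i)
      (fun a b => by simp [hβ]) (by rw [hmS, hrS]; simp) e
    simp only [he i, zero_mul] at h1 h2
    simp [affine, h1, h2]
  · simp [affine, r_pow hL hχ, hrS]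

/-- Every place of the additive group has one of two types, according to which of the two crossed
homomorphisms is not a coboundary. -/
theorem exists_type [NeZero d] [∀ i, Fact (p i).Prime] (hL : HasLifts p d)
    (hχ : ∀ r, χ r = 1 → r = 0) {B : Type*} [SkewBrace B] (π : B ≃+ CharProduct χ) {S T : B}
    {γ N κ : ℕ} (hgen : ∀ b, ∃ y t : ℕ, b = S ^ y * T ^ t) (hS : S ^ γ = 1)
    (hT : T ^ N = 1) (hrel : T * S = S ^ κ * T) (hκ : IsCoprime ((κ : ℤ) - 1) γ)
    (hunit : IsUnit (π T).r) {α m β : B → ∀ i, ZMod (p i)} (hm : ∀ b i, m b i ≠ 0)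
    (hβ : ∀ b i, χ 1 i = 1 → β b i = 0)
    (haff : ∀ b c, π (b * c) = affine χ (α b) (m b) (β b) (π b).r (π c))
    (hαα : ∀ b b', α (b * b') = α b + m b * α b') (hmm : ∀ b b', m (b * b') = m b * m b')
    (hββ : ∀ b b', β (b * b') = β b + m b * χ (-(π b).r) * β b') (i : ι) {P : Prop} [Decidable P]
    (hP : P ↔ (γ : ZMod (p i)) = 0) (hN : P → (N : ZMod (p i)) ≠ 0) :
    ∃ e : Prop, ∃ u₀ : ZMod (p i),
      (e → χ 1 i ≠ 1 ∧ (∀ b, α b i = (1 - m b i) * u₀) ∧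
        m T i * χ (-(π T).r) i = (if P then (κ : ZMod (p i)) else 1) ∧
        β (if P then S else T) i ≠ 0 ∧ (¬ P → β S i = 0)) ∧
      (¬ e → (∀ b, β b i = (1 - m b i * χ (-(π b).r) i) * u₀) ∧
        m T i = (if P then (κ : ZMod (p i)) else 1) ∧
        α (if P then S else T) i ≠ 0 ∧ (¬ P → α S i = 0)) := by
  have hrS := r_eq_zero_of_mul_eq hL hχ π hS hrel hκ
  have hmS : m S i = 1 :=
    eq_one_of_mul_eq (m := fun b => m b i) (fun b => hm b i) (fun a b => by simp [hmm]) hS hrel hκ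
  have d1 := crossedHom_dichotomy (u := fun b => α b i) (μ := fun b => m b i)
    (fun a b => by simp [hαα]) (fun a b => by simp [hmm]) (fun a => hm a i)
    hgen hS hT hrel hmS hP hN
  have d2 := crossedHom_dichotomy (u := fun b => β b i)
    (μ := fun b => m b i * χ (-(π b).r) i)
    (fun a b => by simp [hββ])
    (fun a b => by
      simp only [hmm, r_mul hL hχ, Pi.mul_apply, neg_add, AddChar.map_add_eq_mul]
      ring)
    (fun a => mul_ne_zero (hm a i) (chi_ne_zero _ _))
    hgen hS hT hrel (by simp [hmS, hrS]) hP hN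
  -- If both were coboundaries, the elements with `r = 0` would have `i`-th coordinate `(1 - m b)
  -- (a₀ + b₀)`. This is never `1` if `a₀ + b₀ = 0`, and never `a₀ + b₀` otherwise, against
  -- surjectivity of `π`.
  have hnot : (∃ u₀, ∀ b, α b i = (1 - m b i) * u₀) →
      (∃ u₀, ∀ b, β b i = (1 - m b i * χ (-(π b).r) i) * u₀) → False := by
    rintro ⟨a₀, ha⟩ ⟨b₀, hb⟩
    have hπ : ∀ b, (π b).r = 0 → (π b).x i = (1 - m b i) * (a₀ + b₀) := by
      intro b hb0
      have h := haff b 1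
      rw [mul_one, SkewBrace.one_eq_zero, map_zero] at h
      have h' := congrFun (congrArg CharProduct.x h) i
      simp only [affine, hb0, zero_x, zero_r, mul_zero, add_zero, AddChar.map_zero_eq_one, mul_one,
        Pi.add_apply, ha, hb, neg_zero, Pi.one_apply] at h'
      rw [h']; ring
    by_cases h0 : a₀ + b₀ = 0
    · obtain ⟨b, hb'⟩ := π.surjective ⟨1, 0⟩
      have := hπ b (by rw [hb'])
      rw [h0, mul_zero, hb'] at this
      exact one_ne_zero this
    · classical
      obtain ⟨b, hb'⟩ := π.surjective ⟨Pi.single i (a₀ + b₀), 0⟩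
      have := hπ b (by rw [hb'])
      rw [hb'] at this
      simp only [Pi.single_eq_same] at this
      exact mul_ne_zero (hm b i) h0 (by linear_combination this)
  rcases d1 with h1 | ⟨a₀, h1⟩
  · rcases d2 with h2 | ⟨b₀, h2⟩
    · refine ⟨False, 0, fun h => h.elim, fun _ => ⟨fun b => ?_, h1⟩⟩
      rw [mul_zero]
      apply hβ
      -- If neither is a coboundary, their characters agree at `T`, so `χ (-r(T))` is `1` at `i`; as
      -- `r(T)` is a unit, `χ` is trivial there and `β` vanishes.
      by_contra hi
      refine chi_ne_one_of_isUnit hi hunit ?_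
      have h3 : χ (-(π T).r) i = 1 := (mul_eq_left₀ (hm T i)).1 (h2.1.trans h1.1.symm)
      have := chi_mul_neg (χ := χ) (π T).r i
      rwa [h3, mul_one] at this
    · exact ⟨False, b₀, fun h => h.elim, fun _ => ⟨h2, h1⟩⟩
  · rcases d2 with h2 | h2
    · refine ⟨True, a₀, fun _ => ⟨fun hi => ?_, h1, h2⟩, fun h => absurd trivial h⟩
      exact hnot ⟨a₀, h1⟩ ⟨0, fun b => by rw [hβ b i hi, mul_zero]⟩
    · exact (hnot ⟨a₀, h1⟩ h2).elim

/-- If `T' = S ^ y * T`, then `S` and `T'` generate as `S` and `T` do. -/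
theorem exists_pow_mul_pow_of_mul {B : Type*} [Group B] {S T : B} {γ κ : ℕ} (hγ0 : 0 < γ)
    (hgen : ∀ b, ∃ y t : ℕ, b = S ^ y * T ^ t) (hS : S ^ γ = 1) (hrel : T * S = S ^ κ * T)
    (y : ℕ) (b : B) : ∃ z t : ℕ, b = S ^ z * (S ^ y * T) ^ t := by
  have key : ∀ t : ℕ, ∃ z : ℕ, (S ^ y * T) ^ t = S ^ z * T ^ t := by
    intro t
    induction t with
    | zero => exact ⟨0, by simp⟩
    | succ t ih =>
      obtain ⟨z, hz⟩ := ih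
      refine ⟨z + κ ^ t * y, ?_⟩
      rw [pow_succ, hz, mul_assoc, ← mul_assoc (T ^ t), pow_mul_pow_of_mul_eq hrel, pow_succ,
        pow_add]
      simp only [mul_assoc]
  obtain ⟨a, t, rfl⟩ := hgen b
  obtain ⟨z, hz⟩ := key t
  refine ⟨a + (γ - 1) * z, t, ?_⟩
  have h1 : S ^ ((γ - 1) * z) * S ^ z = 1 := by
    rw [← pow_add, ← Nat.succ_mul, Nat.succ_eq_add_one, Nat.sub_add_cancel hγ0, pow_mul, hS,
      one_pow]
  rw [hz, pow_add, mul_assoc, ← mul_assoc (S ^ ((γ - 1) * z)), h1, one_mul]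

variable [DecidableEq ι] {Γ : Finset ι} {κ : ℕ} {f : Finset ι} {j : ZMod d}

/-- Every skew brace with additive group `CharProduct χ` whose multiplicative group is generated by
`S`, `T` as in a metacyclic group has a normal form. -/
theorem exists_hasNormalForm [Fintype ι] [NeZero d] [∀ i, Fact (p i).Prime] (hL : HasLifts p d)
    (hχ : ∀ r, χ r = 1 → r = 0) {B : Type*} [SkewBrace B] (π : B ≃+ CharProduct χ) {S T : B}
    {γ N : ℕ} (hγ0 : 0 < γ) (hgen : ∀ b, ∃ y t : ℕ, b = S ^ y * T ^ t) (hS : S ^ γ = 1)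
    (hT : T ^ N = 1) (hrel : T * S = S ^ κ * T) (hκ : IsCoprime ((κ : ℤ) - 1) γ)
    (hΓ : ∀ i, i ∈ Γ ↔ (γ : ZMod (p i)) = 0) (hN : ∀ i ∈ Γ, (N : ZMod (p i)) ≠ 0) :
    IsUnit (π T).r ∧ ∃ f : Finset ι, (∀ i ∈ f, χ 1 i ≠ 1) ∧
      HasNormalForm χ Γ κ f (π T).r B := by
  classical
  obtain ⟨α, m, β, hm, hβ, haff, hαα, hmm, hββ⟩ := exists_crossedHoms hL hχ π
  have hrS := r_eq_zero_of_mul_eq hL hχ π hS hrel hκ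
  have hmS : ∀ i, m S i = 1 := fun i =>
    eq_one_of_mul_eq (m := fun b => m b i) (fun b => hm b i) (fun a b => by simp [hmm]) hS hrel hκ
  have hunit : IsUnit (π T).r := by
    obtain ⟨b, hb⟩ := π.surjective ⟨0, 1⟩
    obtain ⟨y, t, rfl⟩ := hgen b
    have h := congrArg CharProduct.r hb
    rw [r_mul hL hχ, r_pow hL hχ, r_pow hL hχ, hrS, smul_zero, zero_add, nsmul_eq_mul] at h
    exact IsUnit.of_mul_eq_one_right _ h
  refine ⟨hunit, ?_⟩
  choose e u₀ he hne using fun i => exists_type hL hχ π hgen hS hT hrel hκ hunit hm hβ haff hαα hmm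
    hββ i (hΓ i) (hN i)
  set f : Finset ι := Finset.univ.filter e with hf
  have hfe : ∀ i, i ∈ f ↔ e i := fun i => by simp [hf]
  replace he := fun i hi => he i ((hfe i).1 hi)
  replace hne := fun i (hi : i ∉ f) => hne i (fun h => hi ((hfe i).2 h))
  clear_value f
  -- `s` scales the noncoboundary to the value `1` at its distinguished generator, and `c` below
  -- cancels the coboundary; its sign differs on `f` by `shear_affine`.
  set s : ∀ i, ZMod (p i) := fun i =>
    (if i ∈ f then β (if i ∈ Γ then S else T) i else α (if i ∈ Γ then S else T) i)⁻¹ with hs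
  have hs0 : ∀ i, s i ≠ 0 := by
    intro i
    apply inv_ne_zero
    by_cases h : i ∈ f
    · rw [if_pos h]; exact (he i h).2.2.2.1
    · rw [if_neg h]; exact (hne i h).2.2.1
  have hsβ : ∀ i ∈ f, s i * β (if i ∈ Γ then S else T) i = 1 := by
    intro i hi
    simp only [hs, if_pos hi]
    exact inv_mul_cancel₀ (he i hi).2.2.2.1
  have hsα : ∀ i ∉ f, s i * α (if i ∈ Γ then S else T) i = 1 := by
    intro i hi
    simp only [hs, if_neg hi]
    exact inv_mul_cancel₀ (hne i hi).2.2.1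
  clear_value s
  set c : ∀ i, ZMod (p i) := fun i => if i ∈ f then -(s i * u₀ i) else s i * u₀ i with hc
  have haff' : ∀ b b', (π.trans (shear χ s c hs0)) (b * b') =
      affine χ (s * α b + (1 - m b) * c) (m b) (s * β b - (1 - m b * χ (-(π b).r)) * c) (π b).r
        ((π.trans (shear χ s c hs0)) b') := by
    intro b b'
    rw [AddEquiv.trans_apply, haff, shear_affine]; rfl
  -- `y` is chosen so that the noncoboundary vanishes at `S ^ y * T` at the places of `Γ`. At the
  -- others it vanishes at `S`, and `y` has no effect.
  obtain ⟨y, hy, -⟩ := hL (fun i => if i ∈ f then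
    -(s i * β T i - (1 - m T i * χ (-(π T).r) i) * c i)
    else -(s i * α T i + (1 - m T i) * c i)) 0
  have hrSy : (π (S ^ y)).r = 0 := by rw [r_pow hL hχ, hrS, smul_zero]
  have hmSy : ∀ i, m (S ^ y) i = 1 := by
    intro i
    clear hy
    have hm1 : m 1 i = 1 := (mul_eq_left₀ (hm 1 i)).1 (by rw [← Pi.mul_apply, ← hmm, mul_one])
    induction y with
    | zero => simpa using hm1
    | succ y ih => rw [pow_succ, hmm, Pi.mul_apply, ih (by rw [r_pow hL hχ, hrS, smul_zero]), hmS,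
        one_mul]
  have hαT : ∀ i, α (S ^ y * T) i = y * α S i + α T i := by
    intro i
    rw [hαα, Pi.add_apply, Pi.mul_apply, hmSy, one_mul, crossedHom_pow (u := fun b => α b i)
      (μ := fun b => m b i) (fun a b => by simp [hαα]) (hmS i)]
  have hβT : ∀ i, β (S ^ y * T) i = y * β S i + β T i := by
    intro i
    rw [hββ, Pi.add_apply, Pi.mul_apply, Pi.mul_apply, hmSy, hrSy, one_mul,
      crossedHom_pow (u := fun b => β b i)
      (μ := fun b => m b i * χ (-(π b).r) i) (fun a b => by simp [hββ]) (by simp [hmS, hrS])]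
    simp
  have hrT : (π (S ^ y * T)).r = (π T).r := by rw [r_mul hL hχ, hrSy, zero_add]
  have hmT : ∀ i, m (S ^ y * T) i = m T i := by intro i; rw [hmm, Pi.mul_apply, hmSy, one_mul]
  have hinv := chi_mul_neg (χ := χ) (π T).r
  have hβf : ∀ i ∉ f, ∀ b, s i * β b i - (1 - m b i * χ (-(π b).r) i) * c i = 0 := by
    intro i hi b
    rw [(hne i hi).1 b]; simp only [hc, if_neg hi]; ring
  have hαf : ∀ i ∈ f, ∀ b, s i * α b i + (1 - m b i) * c i = 0 := by
    intro i hi b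
    rw [(he i hi).2.1 b]; simp only [hc, if_pos hi]; ring
  refine ⟨f, fun i hi => (he i hi).1, π.trans (shear χ s c hs0), S, S ^ y * T,
    exists_pow_mul_pow_of_mul hγ0 hgen hS hrel y, fun b => ?_, fun b => ?_⟩
  · rw [haff', std]
    congr 1
    · funext i
      by_cases hi : i ∈ f
      · simpa [hi] using hαf i hi S
      · have h1 := hsα i hi
        by_cases hG : i ∈ Γ
        · simpa [hi, hG, hmS] using h1
        · simp [hi, hG, hmS, (hne i hi).2.2.2 hG]
    · funext i; simp [hmS]
    · funext i
      by_cases hi : i ∈ f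
      · have h1 := hsβ i hi
        by_cases hG : i ∈ Γ
        · simpa [hi, hG, hmS, hrS] using h1
        · simp [hi, hG, hmS, hrS, (he i hi).2.2.2.2 hG]
      · simpa [hi] using hβf i hi S
    · simpa using hrS
  · rw [haff', std]
    congr 1
    · funext i
      by_cases hi : i ∈ f
      · simpa [hi] using hαf i hi (S ^ y * T)
      · have h1 := hsα i hi
        have h2 := hy i
        have h3 := (hne i hi).2.1
        simp only [if_neg hi, Pi.add_apply, Pi.mul_apply, Pi.sub_apply, Pi.one_apply, hαT,
          hmT] at h2 ⊢
        by_cases hG : i ∈ Γ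
        · simp only [if_pos hG] at h1 ⊢
          push_cast
          linear_combination (y : ZMod (p i)) * h1 + h2
        · simp only [if_neg hG] at h1 h3 ⊢
          rw [(hne i hi).2.2.2 hG, h3]
          push_cast
          linear_combination h1
    · funext i
      rw [hmT]
      by_cases hi : i ∈ f
      · have h3 := (he i hi).2.2.1
        have h4 : m T i = m T i * χ (-(π T).r) i * χ (π T).r i := by
          linear_combination -(m T i) * hinv i
        rw [h4, h3, if_pos hi, pow_one, one_smul]
      · rw [(hne i hi).2.1, if_neg hi, pow_one, mul_one]
    · funext i
      by_cases hi : i ∈ f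
      · have h1 := hsβ i hi
        have h2 := hy i
        have h3 := (he i hi).2.2.1
        simp only [if_pos hi, Pi.mul_apply, Pi.sub_apply, Pi.one_apply, hβT,
          hmT, hrT] at h2 ⊢
        by_cases hG : i ∈ Γ
        · simp only [if_pos hG] at h1 ⊢
          push_cast
          linear_combination (y : ZMod (p i)) * h1 + h2
        · simp only [if_neg hG] at h1 h3 ⊢
          rw [(he i hi).2.2.2.2 hG, h3]
          push_cast
          linear_combination h1
      · simpa [hi] using hβf i hi (S ^ y * T)
    · rw [hrT, one_smul]

end CharProduct

/-! ### Generating pairs and presentations of metacyclic groups -/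

/-- `S` and `T` satisfy the defining relations of the metacyclic group `G(N, γ, κ)` and generate the
ambient group. -/
structure IsMetacyclicPair {G : Type*} [Group G] (γ N κ : ℕ) (S T : G) : Prop where
  pow_left : S ^ γ = 1
  pow_right : T ^ N = 1
  mul_eq : T * S = S ^ κ * T
  exists_eq : ∀ b : G, ∃ y t : ℕ, b = S ^ y * T ^ t

theorem exists_eq_pow_mul_pow {G : Type*} [Group G] {S T : G} {γ N κ : ℕ} (hγ : 0 < γ) (hN : 0 < N)
    (hS : S ^ γ = 1) (hT : T ^ N = 1) (hrel : T * S = S ^ κ * T) {b : G}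
    (hb : b ∈ Subgroup.closure {S, T}) : ∃ y t : ℕ, b = S ^ y * T ^ t := by
  induction hb using Subgroup.closure_induction with
  | mem x hx =>
    rcases hx with rfl | rfl
    · exact ⟨1, 0, by simp⟩
    · exact ⟨0, 1, by simp⟩
  | one => exact ⟨0, 0, by simp⟩
  | mul x y _ _ hx hy =>
    obtain ⟨y, t, rfl⟩ := hx
    obtain ⟨y', t', rfl⟩ := hy
    refine ⟨y + κ ^ t * y', t + t', ?_⟩
    rw [mul_assoc, ← mul_assoc (T ^ t), pow_mul_pow_of_mul_eq hrel, pow_add, pow_add]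
    simp only [mul_assoc]
  | inv x _ hx =>
    obtain ⟨y, t, rfl⟩ := hx
    have h1 : (S ^ y)⁻¹ = S ^ ((γ - 1) * y) := by
      rw [inv_eq_iff_mul_eq_one, ← pow_add, show y + (γ - 1) * y = (1 + (γ - 1)) * y by ring, Nat.add_sub_cancel' hγ,
        pow_mul, hS, one_pow]
    have h2 : (T ^ t)⁻¹ = T ^ ((N - 1) * t) := by
      rw [inv_eq_iff_mul_eq_one, ← pow_add, show t + (N - 1) * t = (1 + (N - 1)) * t by ring, Nat.add_sub_cancel' hN,
        pow_mul, hT, one_pow]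
    rw [mul_inv_rev, h1, h2, pow_mul_pow_of_mul_eq hrel]
    exact ⟨_, _, rfl⟩

theorem IsMetacyclicPair.surjective {G : Type*} [Group G] {S T : G} {γ N κ : ℕ}
    (h : IsMetacyclicPair γ N κ S T) (hγ : 0 < γ) (hN : 0 < N) :
    Function.Surjective (fun a : Fin γ × Fin N => S ^ (a.1 : ℕ) * T ^ (a.2 : ℕ)) := by
  intro b
  obtain ⟨y, t, rfl⟩ := h.exists_eq b
  refine ⟨(⟨y % γ, Nat.mod_lt _ hγ⟩, ⟨t % N, Nat.mod_lt _ hN⟩), ?_⟩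
  dsimp only
  rw [← pow_mod_orderOf S y, ← pow_mod_orderOf T t,
    ← pow_mod_orderOf S (y % γ), ← pow_mod_orderOf T (t % N),
    Nat.mod_mod_of_dvd _ (orderOf_dvd_of_pow_eq_one h.pow_left),
    Nat.mod_mod_of_dvd _ (orderOf_dvd_of_pow_eq_one h.pow_right)]

theorem IsMetacyclicPair.finite {G : Type*} [Group G] {S T : G} {γ N κ : ℕ}
    (h : IsMetacyclicPair γ N κ S T) (hγ : 0 < γ) (hN : 0 < N) : Finite G :=
  Finite.of_surjective _ (h.surjective hγ hN)

theorem IsMetacyclicPair.card_le {G : Type*} [Group G] {S T : G} {γ N κ : ℕ}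
    (h : IsMetacyclicPair γ N κ S T) (hγ : 0 < γ) (hN : 0 < N) : Nat.card G ≤ γ * N := by
  simpa [Nat.card_prod] using Nat.card_le_card_of_surjective _ (h.surjective hγ hN)

theorem IsMetacyclicPair.map {G H : Type*} [Group G] [Group H] {S T : G} {γ N κ : ℕ}
    (h : IsMetacyclicPair γ N κ S T) (φ : G ≃* H) : IsMetacyclicPair γ N κ (φ S) (φ T) where
  pow_left := by rw [← map_pow, h.pow_left, map_one]
  pow_right := by rw [← map_pow, h.pow_right, map_one]
  mul_eq := by rw [← map_mul, h.mul_eq, map_mul, map_pow]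
  exists_eq b := by
    obtain ⟨y, t, hb⟩ := h.exists_eq (φ.symm b)
    exact ⟨y, t, by rw [← φ.apply_symm_apply b, hb, map_mul, map_pow, map_pow]⟩

/-- If the group has the largest possible order, then `S` has order `γ`. -/
theorem IsMetacyclicPair.dvd_of_pow_eq_one {G : Type*} [Group G] {S T : G} {γ N κ e : ℕ}
    (h : IsMetacyclicPair γ N κ S T) (hγ : 0 < γ) (hN : 0 < N) (hcard : Nat.card G = γ * N)
    (he : S ^ e = 1) : γ ∣ e := by
  have hS : S ^ Nat.gcd γ e = 1 := pow_gcd_eq_one.2 ⟨h.pow_left, he⟩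
  have hpos : 0 < Nat.gcd γ e := Nat.gcd_pos_of_pos_left _ hγ
  -- The same pair satisfies the relations with `gcd γ e` for `γ`, which bounds the order of the
  -- group by `gcd γ e * N`.
  have h' : IsMetacyclicPair (Nat.gcd γ e) N κ S T := ⟨hS, h.pow_right, h.mul_eq, h.exists_eq⟩
  have h1 := h'.card_le hpos hN
  rw [hcard] at h1
  have h2 : γ ≤ Nat.gcd γ e := Nat.le_of_mul_le_mul_right h1 hN
  exact Nat.gcd_eq_left_iff_dvd.1 (Nat.le_antisymm (Nat.le_of_dvd hγ (Nat.gcd_dvd_left _ _)) h2)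

namespace MetacyclicGroup

variable {d e : ℕ} {k : ℤ} {κ : ℕ}

theorem zpow_eq_pow_of_cast_eq {G : Type*} [Group G] {s : G} (hk : (k : ZMod e) = (κ : ZMod e))
    (hs : s ^ e = 1) : s ^ k = s ^ κ := by
  have h : (e : ℤ) ∣ κ - k := by
    rw [← ZMod.intCast_eq_intCast_iff_dvd_sub]; simpa using hk
  obtain ⟨c, hc⟩ := h
  rw [← zpow_natCast s κ, show (κ : ℤ) = k + e * c by omega, zpow_add, zpow_mul, zpow_natCast, hs,
    one_zpow, mul_one]

/-- The universal property of a metacyclic group. -/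
theorem exists_lift (hk : (k : ZMod e) = (κ : ZMod e)) {H : Type*} [Group H] {s t : H}
    (hs : s ^ e = 1) (ht : t ^ d = 1) (hst : t * s = s ^ κ * t) :
    ∃ ρ : MetacyclicGroup d e k →* H,
      ρ (PresentedGroup.of 0) = s ∧ ρ (PresentedGroup.of 1) = t := by
  refine ⟨PresentedGroup.toGroup (f := ![s, t]) ?_, ?_, ?_⟩
  · intro r hr
    rcases hr with rfl | rfl | rfl
    · simpa using hs
    · simpa using ht
    · simp only [map_mul, map_inv, map_zpow, FreeGroup.lift_apply_of, Matrix.cons_val_zero,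
        Matrix.cons_val_one]
      rw [zpow_eq_pow_of_cast_eq hk hs, hst]
      group
  · rw [PresentedGroup.toGroup.of]; rfl
  · rw [PresentedGroup.toGroup.of]; rfl

theorem isMetacyclicPair (hk : (k : ZMod e) = (κ : ZMod e)) (hd : 0 < d) (he : 0 < e) :
    IsMetacyclicPair e d κ (PresentedGroup.of 0 : MetacyclicGroup d e k) (PresentedGroup.of 1) := by
  have h0 : (PresentedGroup.of 0 : MetacyclicGroup d e k) ^ e = 1 :=
    PresentedGroup.one_of_mem (x := FreeGroup.of 0 ^ e) (Set.mem_insert _ _)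
  have h1 : (PresentedGroup.of 1 : MetacyclicGroup d e k) ^ d = 1 :=
    PresentedGroup.one_of_mem (x := FreeGroup.of 1 ^ d)
      (Set.mem_insert_of_mem _ (Set.mem_insert _ _))
  have h2 : (PresentedGroup.of 1 : MetacyclicGroup d e k) * PresentedGroup.of 0 *
      (PresentedGroup.of 1)⁻¹ * (PresentedGroup.of 0 ^ k)⁻¹ = 1 :=
    PresentedGroup.one_of_mem
      (x := FreeGroup.of 1 * FreeGroup.of 0 * (FreeGroup.of 1)⁻¹ * (FreeGroup.of 0 ^ k)⁻¹)
      (Set.mem_insert_of_mem _ (Set.mem_insert_of_mem _ rfl))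
  have h3 : (PresentedGroup.of 1 : MetacyclicGroup d e k) * PresentedGroup.of 0 =
      PresentedGroup.of 0 ^ κ * PresentedGroup.of 1 := by
    rw [mul_inv_eq_one, mul_inv_eq_iff_eq_mul, zpow_eq_pow_of_cast_eq hk h0] at h2
    exact h2
  refine ⟨h0, h1, h3, fun b => exists_eq_pow_mul_pow he hd h0 h1 h3 ?_⟩
  apply PresentedGroup.generated_by
  intro i
  fin_cases i
  · exact Subgroup.subset_closure (Set.mem_insert _ _)
  · exact Subgroup.subset_closure (Set.mem_insert_of_mem _ rfl)

end MetacyclicGroup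

/-! ### The coordinate model and the realisation of normal forms -/

namespace CharProduct

variable {ι : Type} {p : ι → ℕ} {d : ℕ} {χ : AddChar (ZMod d) (∀ i, ZMod (p i))}

theorem card_eq [Fintype ι] (χ : AddChar (ZMod d) (∀ i, ZMod (p i))) :
    Nat.card (CharProduct χ) = (∏ i, p i) * d := by
  rw [Nat.card_congr (equivProd χ), Nat.card_prod, Nat.card_pi]
  simp

/-- A metacyclic group is a group of pairs. -/
theorem nonempty_mulEquiv_metacyclicGroup [Fintype ι] (hL : HasLifts p d) {e : ℕ} {k : ℤ} {κ : ℕ}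
    (hk : (k : ZMod e) = (κ : ZMod e)) (he : e = ∏ i, p i) (hd : 0 < d) (he0 : 0 < e)
    (hχ : ∀ i, χ 1 i = κ) :
    Nonempty (MetacyclicGroup d e k ≃* Multiplicative (CharProduct χ)) := by
  have hpair := MetacyclicGroup.isMetacyclicPair hk hd he0
  have : Finite (MetacyclicGroup d e k) := hpair.finite he0 hd
  obtain ⟨ρ, hρ0, hρ1⟩ := MetacyclicGroup.exists_lift (d := d) hk
    (s := Multiplicative.ofAdd (⟨1, 0⟩ : CharProduct χ))
    (t := Multiplicative.ofAdd (⟨0, 1⟩ : CharProduct χ))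
    (by
      rw [← ofAdd_nsmul, nsmul_mk_zero, ofAdd_eq_one]
      ext1
      · funext i
        have : ((e : ℕ) : ZMod (p i)) = 0 :=
          (ZMod.natCast_eq_zero_iff _ _).2 (he ▸ Finset.dvd_prod_of_mem p (Finset.mem_univ i))
        simp [this]
      · rfl)
    (by
      rw [← ofAdd_nsmul, nsmul_zero_mk, ofAdd_eq_one]
      ext1
      · rfl
      · simp)
    (by
      rw [← ofAdd_nsmul, ← ofAdd_add, ← ofAdd_add, nsmul_mk_zero]
      congr 1
      ext1
      · funext i; simp [hχ]
      · simp)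
  refine ⟨MulEquiv.ofBijective ρ (Function.Surjective.bijective_of_nat_card_le ?_ ?_)⟩
  · intro a
    obtain ⟨⟨x, r⟩, rfl⟩ := Multiplicative.ofAdd.surjective a
    obtain ⟨y, hy, -⟩ := hL x 0
    obtain ⟨t, -, ht⟩ := hL 0 r
    refine ⟨PresentedGroup.of 0 ^ y * PresentedGroup.of 1 ^ t, ?_⟩
    rw [map_mul, map_pow, map_pow, hρ0, hρ1, ← ofAdd_nsmul, ← ofAdd_nsmul, ← ofAdd_add,
      nsmul_mk_zero, nsmul_zero_mk]
    congr 1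
    ext1
    · funext i; simp [hy i]
    · simp [ht]
  · refine (hpair.card_le he0 hd).trans (le_of_eq ?_)
    rw [Nat.card_congr Multiplicative.toAdd, card_eq, he]

variable [DecidableEq ι] {Γ : Finset ι} {κ : ℕ} {f : Finset ι} {j : ZMod d}

theorem std_left_eq_self {y : ℕ} (hy : ∀ i ∈ Γ, (y : ZMod (p i)) = 0) (a : CharProduct χ) :
    std χ Γ κ f j y 0 a = a := by
  ext1
  · funext i
    by_cases hi : i ∈ Γ
    · simp [std, affine, hy i hi]
    · simp [std, affine, hi]
  · simp [std, affine]

theorem std_right_eq_self {t : ℕ} (ht : ∀ i ∉ Γ, (t : ZMod (p i)) = 0)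
    (hκ : ∀ i ∈ Γ, (κ : ZMod (p i)) ^ t = 1) (htd : t • j = 0) (a : CharProduct χ) :
    std χ Γ κ f j 0 t a = a := by
  ext1
  · funext i
    by_cases hi : i ∈ Γ
    · simp only [std, affine, htd]
      simp [hi, hκ i hi]
    · simp only [std, affine, htd]
      simp [hi, ht i hi]
  · simp [std, affine, htd]

/-- All normal forms are realised. -/
theorem exists_skewBraceOver_hasNormalForm [Fintype ι] [NeZero d] (hL : HasLifts p d)
    {M A : Type u} [Group M] [Group A]
    (hA : Nonempty (A ≃* Multiplicative (CharProduct χ))) {S T : M} {γ N : ℕ} (hγ0 : 0 < γ)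
    (hN0 : 0 < N) (hST : IsMetacyclicPair γ N κ S T)
    (hlift : ∀ s t : Equiv.Perm (CharProduct χ), s ^ γ = 1 → t ^ N = 1 → t * s = s ^ κ * t →
      ∃ ρ : M →* Equiv.Perm (CharProduct χ), ρ S = s ∧ ρ T = t)
    (hcard : γ * N = (∏ i, p i) * d) (hΓ : ∀ i ∈ Γ, (γ : ZMod (p i)) = 0)
    (hN : ∀ i ∉ Γ, (N : ZMod (p i)) = 0) (hκ : ∀ i ∈ Γ, (κ : ZMod (p i)) ^ N = 1) (hdN : d ∣ N)
    (f : Finset ι) (hj : IsUnit j) :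
    ∃ B : SkewBraceOver M A, HasNormalForm χ Γ κ f j B.carrier := by
  have hNj : N • j = 0 := by
    rw [nsmul_eq_mul, (ZMod.natCast_eq_zero_iff _ _).2 hdN, zero_mul]
  have hNid := std_right_eq_self (χ := χ) (f := f) hN hκ hNj
  have hγid := std_left_eq_self (χ := χ) (κ := κ) (f := f) (j := j) hΓ
  let s : Equiv.Perm (CharProduct χ) :=
    { toFun := std χ Γ κ f j 1 0
      invFun := std χ Γ κ f j (γ - 1) 0
      left_inv := fun a => by
        rw [std_std, pow_zero, one_mul, add_zero, Nat.sub_add_cancel hγ0, hγid]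
      right_inv := fun a => by
        rw [std_std, pow_zero, one_mul, add_zero, Nat.add_sub_cancel' hγ0, hγid] }
  let t : Equiv.Perm (CharProduct χ) :=
    { toFun := std χ Γ κ f j 0 1
      invFun := std χ Γ κ f j 0 (N - 1)
      left_inv := fun a => by
        rw [std_std, mul_zero, add_zero, Nat.sub_add_cancel hN0, hNid]
      right_inv := fun a => by
        rw [std_std, mul_zero, add_zero, Nat.add_sub_cancel' hN0, hNid] }
  have hst : ∀ (y z : ℕ) (a : CharProduct χ), (s ^ y * t ^ z) a = std χ Γ κ f j y z a := by
    intro y z a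
    have := std_pow_mul (π := fun g : Equiv.Perm (CharProduct χ) => g a) (S := s) (T := t)
      (fun _ => rfl) (fun _ => rfl) y z 1
    simpa using this
  obtain ⟨ρ, hρS, hρT⟩ := hlift s t
    (by ext1 a; simpa [hγid] using hst γ 0 a)
    (by ext1 a; simpa [hNid] using hst 0 N a)
    (by
      ext1 a
      have h1 := hst κ 1 a
      rw [pow_one] at h1
      rw [h1]
      change std χ Γ κ f j 0 1 (std χ Γ κ f j 1 0 a) = _
      rw [std_std]; simp)
  have hρ : ∀ g, ∃ y z : ℕ, ∀ a, ρ g a = std χ Γ κ f j y z a := by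
    intro g
    obtain ⟨y, z, rfl⟩ := hST.exists_eq g
    exact ⟨y, z, fun a => by rw [map_mul, map_pow, map_pow, hρS, hρT, hst]⟩
  -- The orbit of `0` is everything. One exponent `z` serves for both `S` and `T`, because at each
  -- place only one of the two exponents enters the translation part.
  have hsurj : Function.Surjective (fun g : M => ρ g 0) := by
    rintro ⟨x, r⟩
    obtain ⟨v, hv⟩ := hj.exists_left_inv
    obtain ⟨z, hz, hzr⟩ := hL (fun i => if i ∈ f then x i * χ (-r) i else x i) (r * v)
    refine ⟨S ^ z * T ^ z, ?_⟩
    have hzj : z • j = r := by rw [nsmul_eq_mul, hzr, mul_assoc, hv, mul_one]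
    simp only [map_mul, map_pow, hρS, hρT]
    rw [hst]
    ext1
    · funext i
      have := chi_mul_neg (χ := χ) r i
      by_cases hf : i ∈ f
      · simp only [std, affine, hzj, hf, hz, if_true, ite_self, zero_x, zero_r, mul_zero, add_zero,
          zero_add, Pi.add_apply, Pi.mul_apply]
        linear_combination (x i) * this
      · simp [std, affine, hf, hz]
    · simp [std, affine, ← hzj]
  have : Finite M := hST.finite hγ0 hN0
  let π : M ≃ CharProduct χ := Equiv.ofBijective _ (hsurj.bijective_of_nat_card_le
    (by rw [card_eq, ← hcard]; exact hST.card_le hγ0 hN0))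
  have hπ : ∀ g h, π (g * h) = ρ g (π h) := fun g h => by
    change ρ (g * h) 0 = ρ g (ρ h 0)
    rw [map_mul]; rfl
  -- The orbit map is bijective by counting; addition is transported along it, and `affine_add`
  -- gives the brace identity.
  let _ : AddGroup M := π.addGroup
  let πa : M ≃+ CharProduct χ := { π with map_add' := fun a b => π.apply_symm_apply _ }
  let _ : SkewBrace M :=
    { toAddGroup := π.addGroup
      toGroup := inferInstance
      mul_add_skew := fun a b c => by
        apply πa.injective
        rw [map_add, map_add, map_neg]
        change π _ = π _ + -π a + π _
        rw [hπ, hπ, hπ]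
        obtain ⟨y, z, h⟩ := hρ a
        have ha : π a = ρ a 0 := rfl
        rw [ha, h, h, h, h]
        change std χ Γ κ f j y z (πa (b + c)) = _
        rw [map_add]
        exact affine_add _ _ _ _ _ _ }
  obtain ⟨φ⟩ := hA
  refine ⟨{ carrier := M, mul_iso := ⟨MulEquiv.refl M⟩,
            add_iso := ⟨(AddEquiv.toMultiplicative πa).trans φ.symm⟩ }, πa, S, T, hST.exists_eq,
            fun b => ?_, fun b => ?_⟩
  · change π _ = std χ Γ κ f j 1 0 (π b)
    rw [hπ, hρS]; rfl
  · change π _ = std χ Γ κ f j 0 1 (π b)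
    rw [hπ, hρT]; rfl

end CharProduct

/-! ### Squarefree moduli, characters and lifts of units -/

section NumberTheory

theorem Squarefree.dvd_of_forall_primeFactors {e : ℕ} (he : Squarefree e) {a : ℕ}
    (h : ∀ q ∈ e.primeFactors, q ∣ a) : e ∣ a := by
  rw [← Nat.prod_primeFactors_of_squarefree he]
  exact Finset.prod_primes_dvd _ (fun q hq => (Nat.prime_of_mem_primeFactors hq).prime) h

theorem Squarefree.zmod_natCast_eq_iff {e : ℕ} (he : Squarefree e) {a b : ℕ} :
    (a : ZMod e) = b ↔ ∀ q ∈ e.primeFactors, (a : ZMod q) = b := by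
  have key : ∀ n : ℕ, (a : ZMod n) = b ↔ n ∣ ((b : ℤ) - a).natAbs := by
    intro n
    rw [← Int.natCast_dvd, ← ZMod.intCast_eq_intCast_iff_dvd_sub]
    simp
  rw [key]
  refine ⟨fun h q hq => (key q).2 ((Nat.dvd_of_mem_primeFactors hq).trans h), fun h => ?_⟩
  exact he.dvd_of_forall_primeFactors fun q hq => (key q).1 (h q hq)

theorem prod_primeFactors_coe {e : ℕ} (he : Squarefree e) :
    ∏ q : e.primeFactors, (q : ℕ) = e := by
  rw [Finset.prod_coe_sort e.primeFactors (fun q => q), Nat.prod_primeFactors_of_squarefree he]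

instance fact_prime_primeFactors (e : ℕ) (q : e.primeFactors) : Fact (q : ℕ).Prime :=
  ⟨Nat.prime_of_mem_primeFactors q.2⟩

theorem hasLifts_primeFactors {d e : ℕ} [NeZero d] (he : Squarefree e) (hde : Nat.Coprime d e) :
    CharProduct.HasLifts (fun q : e.primeFactors => (q : ℕ)) d := by
  intro x r
  have hco : Pairwise (Function.onFun Nat.Coprime fun q : e.primeFactors => (q : ℕ)) := by
    intro q q' hqq
    exact (Nat.coprime_primes (Nat.prime_of_mem_primeFactors q.2)
      (Nat.prime_of_mem_primeFactors q'.2)).2 (fun h => hqq (Subtype.ext h))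
  have hpe := prod_primeFactors_coe he
  have : NeZero (∏ q : e.primeFactors, (q : ℕ)) := ⟨by rw [hpe]; exact he.ne_zero⟩
  set z := (ZMod.prodEquivPi _ hco).symm x with hz
  obtain ⟨t, ht1, ht2⟩ := Nat.chineseRemainder (hpe.symm ▸ hde.symm) z.val r.val
  refine ⟨t, fun q => ?_, ?_⟩
  · have h1 : (t : ZMod (∏ q : e.primeFactors, (q : ℕ))) = z := by
      rw [(ZMod.natCast_eq_natCast_iff _ _ _).2 ht1, ZMod.natCast_zmod_val]
    have h2 := congrFun (congrArg (ZMod.prodEquivPi _ hco) h1) q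
    rw [hz, RingEquiv.apply_symm_apply, map_natCast] at h2
    simpa using h2
  · rw [(ZMod.natCast_eq_natCast_iff _ _ _).2 ht2, ZMod.natCast_zmod_val]

/-- The character of `ℤ/d` with values in `∏ ℤ/q`, `q` running over the primes dividing `e`, that is
given by an element of `(ℤ/e)ˣ` of order dividing `d`. -/
theorem exists_addChar {d e κ : ℕ} [NeZero d] (he : Squarefree e) (hκ : (κ : ZMod e) ^ d = 1) :
    ∃ χ : AddChar (ZMod d) (∀ q : e.primeFactors, ZMod q), (∀ q, χ 1 q = κ) ∧
      (orderOf (κ : ZMod e) = d → ∀ r, χ r = 1 → r = 0) := by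
  have hz : (fun q : e.primeFactors => (κ : ZMod q)) ^ d = 1 := by
    funext q
    have h : ((κ ^ d : ℕ) : ZMod e) = (1 : ℕ) := by push_cast; exact hκ
    have := he.zmod_natCast_eq_iff.1 h q q.2
    push_cast at this
    simpa using this
  refine ⟨AddChar.zmodChar d hz, fun q => ?_, fun hord r hr => ?_⟩
  · have := AddChar.zmodChar_apply' hz 1
    rw [pow_one, Nat.cast_one] at this
    rw [this]
  · rw [AddChar.zmodChar_apply] at hr
    have h : ((κ ^ r.val : ℕ) : ZMod e) = (1 : ℕ) := by
      rw [he.zmod_natCast_eq_iff]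
      intro q hq
      have := congrFun hr ⟨q, hq⟩
      push_cast
      simpa using this
    push_cast at h
    have h1 := orderOf_dvd_of_pow_eq_one h
    rw [hord] at h1
    exact (ZMod.val_eq_zero r).1 (Nat.eq_zero_of_dvd_of_lt h1 (ZMod.val_lt r))

/-- Units with the same image modulo a common divisor differ by a factor that is prime to `N`. -/
theorem exists_coprime_mul_eq {d δ N : ℕ} [NeZero d] [NeZero N] (hd : d ∣ N) (hδ : δ ∣ N)
    {j l : (ZMod d)ˣ} (h : ZMod.unitsMap (Nat.gcd_dvd_right δ d) j =
      ZMod.unitsMap (Nat.gcd_dvd_right δ d) l) :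
    ∃ r : ℕ, r.Coprime N ∧ r ≡ 1 [MOD δ] ∧ (r : ZMod d) * j = l := by
  set w := l * j⁻¹ with hw
  have hw1 : ZMod.unitsMap (Nat.gcd_dvd_right δ d) w = 1 := by
    rw [hw, map_mul, map_inv, h, mul_inv_cancel]
  have hmod : 1 ≡ (w : ZMod d).val [MOD Nat.gcd δ d] := by
    rw [← ZMod.natCast_eq_natCast_iff]
    have h2 := congrArg Units.val hw1
    rw [ZMod.unitsMap_val, Units.val_one] at h2
    rw [Nat.cast_one, ← h2, ZMod.cast_eq_val]
  -- The congruences `x ≡ 1` modulo `δ` and `x ≡ w` modulo `d` are compatible since `w ≡ 1` modulo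
  -- the gcd. This `x` is prime only to the lcm, so it is then lifted to a unit modulo `N`.
  obtain ⟨x, hx1, hx2⟩ := Nat.chineseRemainder' hmod
  have hxd : x.Coprime d := by
    rw [← ZMod.isUnit_iff_coprime, (ZMod.natCast_eq_natCast_iff _ _ _).2 hx2, ZMod.natCast_zmod_val]
    exact w.isUnit
  have hxδ : x.Coprime δ := by
    rw [← ZMod.isUnit_iff_coprime, (ZMod.natCast_eq_natCast_iff _ _ _).2 hx1, Nat.cast_one]
    exact isUnit_one
  have hlcm : Nat.lcm δ d ∣ N := Nat.lcm_dvd hδ hd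
  have hxl : x.Coprime (Nat.lcm δ d) :=
    Nat.Coprime.coprime_dvd_right (Nat.lcm_dvd_mul δ d) (Nat.Coprime.mul_right hxδ hxd)
  obtain ⟨v, hv⟩ := ZMod.unitsMap_surjective hlcm (ZMod.unitOfCoprime x hxl)
  have hvx : (v : ZMod N).val ≡ x [MOD Nat.lcm δ d] := by
    rw [← ZMod.natCast_eq_natCast_iff]
    have h2 := congrArg Units.val hv
    rw [ZMod.unitsMap_val, ZMod.coe_unitOfCoprime, ZMod.cast_eq_val] at h2
    exact h2
  refine ⟨(v : ZMod N).val, ?_, ?_, ?_⟩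
  · rw [← ZMod.isUnit_iff_coprime, ZMod.natCast_zmod_val]
    exact v.isUnit
  · exact (hvx.of_dvd (Nat.dvd_lcm_left δ d)).trans hx1
  · have h3 : ((v : ZMod N).val : ZMod d) = w := by
      rw [(ZMod.natCast_eq_natCast_iff _ _ _).2 ((hvx.of_dvd (Nat.dvd_lcm_right δ d)).trans hx2),
        ZMod.natCast_zmod_val]
    rw [h3, ← Units.val_mul, hw, inv_mul_cancel_right]

end NumberTheory

/-! ### Orders of metacyclic groups and change of presentation -/

namespace MetacyclicGroup

theorem card_eq {d e : ℕ} {k : ℤ} (hd : 0 < d) (he : Squarefree e) (hde : Nat.Coprime d e)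
    (hk : (k : ZMod e) ^ d = 1) : Nat.card (MetacyclicGroup d e k) = e * d := by
  have : NeZero d := ⟨hd.ne'⟩
  have : NeZero e := ⟨he.ne_zero⟩
  have hκ : (k : ZMod e) = ((k : ZMod e).val : ZMod e) := (ZMod.natCast_zmod_val _).symm
  obtain ⟨χ, hχ, -⟩ := exists_addChar (d := d) (κ := (k : ZMod e).val) he (by rwa [← hκ])
  obtain ⟨φ⟩ := CharProduct.nonempty_mulEquiv_metacyclicGroup (hasLifts_primeFactors he hde) hκ
    (prod_primeFactors_coe he).symm hd (Nat.pos_of_ne_zero he.ne_zero) hχ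
  rw [Nat.card_congr φ.toEquiv, Nat.card_congr Multiplicative.toAdd, CharProduct.card_eq,
    prod_primeFactors_coe he]

/-- Conjugation by `T` sends `S ^ γ` to `S ^ (κ * γ)`, and `κ * γ ≡ γ` modulo `γ * ζ`. -/
theorem commute_pow_of_modEq {G : Type*} [Group G] {S T : G} {γ ζ κ : ℕ} (hS : S ^ (γ * ζ) = 1)
    (hrel : T * S = S ^ κ * T) (hκ : κ ≡ 1 [MOD ζ]) : Commute (S ^ γ) T := by
  have h1 := pow_mul_pow_of_mul_eq hrel γ 1
  have h2 : S ^ (κ * γ) = S ^ γ := by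
    rw [pow_eq_pow_iff_modEq]
    have h3 := (hκ.mul_left' γ).of_dvd (orderOf_dvd_of_pow_eq_one hS)
    rwa [mul_one, mul_comm γ κ] at h3
  rw [pow_one, pow_one, h2] at h1
  exact h1.symm

/-- The central part of the normal cyclic subgroup can be moved to the other factor. -/
theorem nonempty_mulEquiv {δ γ ζ : ℕ} {κ : ℤ} (hδ : 0 < δ) (hsq : Squarefree (δ * (γ * ζ)))
    (hκζ : (ζ : ℤ) ∣ κ - 1) (hκ : (κ : ZMod (γ * ζ)) ^ δ = 1) :
    Nonempty (MetacyclicGroup (δ * ζ) γ κ ≃* MetacyclicGroup δ (γ * ζ) κ) := by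
  obtain ⟨hco, -, hsqε⟩ := Nat.squarefree_mul_iff.1 hsq
  have hε0 : 0 < γ * ζ := Nat.pos_of_ne_zero hsqε.ne_zero
  have hγ0 : 0 < γ := Nat.pos_of_mul_pos_right hε0
  have hζ0 : 0 < ζ := Nat.pos_of_mul_pos_left hε0
  have : NeZero (γ * ζ) := ⟨hε0.ne'⟩
  set κ' := (κ : ZMod (γ * ζ)).val
  have hκ' : (κ : ZMod (γ * ζ)) = (κ' : ZMod (γ * ζ)) := (ZMod.natCast_zmod_val _).symm
  have hκγ : (κ : ZMod γ) = (κ' : ZMod γ) := by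
    have := congrArg (ZMod.castHom (Dvd.intro ζ rfl) (ZMod γ)) hκ'
    simpa using this
  obtain ⟨hS, hT, hrel, hgen⟩ := isMetacyclicPair (d := δ) hκ' hδ hε0
  set S : MetacyclicGroup δ (γ * ζ) κ := PresentedGroup.of 0
  set T : MetacyclicGroup δ (γ * ζ) κ := PresentedGroup.of 1
  have hκ1 : κ' ≡ 1 [MOD ζ] := by
    rw [← ZMod.natCast_eq_natCast_iff]
    have h1 := congrArg (ZMod.castHom (Dvd.intro_left γ rfl) (ZMod ζ)) hκ'
    have h2 := (ZMod.intCast_zmod_eq_zero_iff_dvd _ _).2 hκζ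
    push_cast at h2
    simp only [map_intCast, map_natCast] at h1
    rw [← h1, Nat.cast_one]
    exact sub_eq_zero.1 h2
  have hcomm : Commute (S ^ γ) T := commute_pow_of_modEq hS hrel hκ1
  -- The new `T` is a product of commuting elements whose orders divide the coprime numbers `ζ` and
  -- `δ`.
  obtain ⟨ρ, hρ0, hρ1⟩ := exists_lift (d := δ * ζ) hκγ (s := S ^ ζ) (t := S ^ γ * T)
    (by rw [← pow_mul']; exact hS)
    (by
      rw [hcomm.mul_pow, ← pow_mul, pow_mul T, hT, one_pow, mul_one,
        show γ * (δ * ζ) = γ * ζ * δ by ring, pow_mul, hS, one_pow])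
    (by
      have h1 := pow_mul_pow_of_mul_eq hrel ζ 1
      rw [pow_one, pow_one] at h1
      rw [mul_assoc, h1, ← mul_assoc, ← mul_assoc, ← pow_mul, ← pow_add, ← pow_add]
      ring_nf)
  have hsurj : Function.Surjective ρ := by
    rw [← MonoidHom.range_eq_top, eq_top_iff]
    have hSζ : S ^ ζ ∈ ρ.range := ⟨_, hρ0⟩
    have hSγT : S ^ γ * T ∈ ρ.range := ⟨_, hρ1⟩
    have hSγδ : S ^ (γ * δ) ∈ ρ.range := by
      have := pow_mem hSγT δ
      rwa [hcomm.mul_pow, hT, mul_one, ← pow_mul] at this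
    -- The image contains `S ^ ζ` and `S ^ (γ * δ)`, hence `S`, and then `T`.
    have hcop : Nat.Coprime (γ * δ) ζ := by
      rw [show δ * (γ * ζ) = (γ * δ) * ζ by ring] at hsq
      exact Nat.coprime_of_squarefree_mul hsq
    obtain ⟨a, b, hab⟩ := Nat.isCoprime_iff_coprime.2 hcop
    have hSmem : S ∈ ρ.range := by
      rw [← zpow_one S, ← hab, zpow_add, mul_comm a, mul_comm b, zpow_mul, zpow_mul, zpow_natCast,
        zpow_natCast]
      exact mul_mem (zpow_mem hSγδ a) (zpow_mem hSζ b)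
    have hTmem : T ∈ ρ.range := (Subgroup.mul_mem_cancel_left _ (pow_mem hSmem γ)).1 hSγT
    intro b _
    obtain ⟨y, t, rfl⟩ := hgen b
    exact mul_mem (pow_mem hSmem y) (pow_mem hTmem t)
  have hpair := isMetacyclicPair (d := δ * ζ) hκγ (Nat.mul_pos hδ hζ0) hγ0
  have := hpair.finite hγ0 (Nat.mul_pos hδ hζ0)
  refine ⟨MulEquiv.ofBijective ρ (hsurj.bijective_of_nat_card_le ?_)⟩
  refine (hpair.card_le hγ0 (Nat.mul_pos hδ hζ0)).trans (le_of_eq ?_)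
  rw [card_eq hδ hsqε hco hκ]; ring

end MetacyclicGroup

/-- Replacing `T` by a power that generates the same subgroup and acts on `S` in the same way. -/
theorem IsMetacyclicPair.pow_right_pair {G : Type*} [Group G] {S T : G} {γ N κ r : ℕ}
    (h : IsMetacyclicPair γ N κ S T) (hr : r.Coprime N) (hκ : κ ^ r ≡ κ [MOD γ]) :
    IsMetacyclicPair γ N κ S (T ^ r) where
  pow_left := h.pow_left
  pow_right := by rw [← pow_mul, mul_comm, pow_mul, h.pow_right, one_pow]
  mul_eq := by
    have h1 := pow_mul_pow_of_mul_eq h.mul_eq 1 r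
    rw [pow_one, mul_one] at h1
    rw [h1]
    congr 1
    exact pow_eq_pow_iff_modEq.2 (hκ.of_dvd (orderOf_dvd_of_pow_eq_one h.pow_left))
  exists_eq b := by
    obtain ⟨y, t, rfl⟩ := h.exists_eq b
    obtain ⟨v, hv⟩ := exists_pow_eq_self_of_coprime
      (hr.coprime_dvd_right (orderOf_dvd_of_pow_eq_one h.pow_right))
    exact ⟨y, v * t, by rw [pow_mul, hv]⟩

theorem card_normalFormTypes {ι : Type} [Fintype ι] [DecidableEq ι] (P : ι → Prop)
    [DecidablePred P] :
    Nat.card {f : Finset ι // ∀ i ∈ f, P i} = 2 ^ (Finset.univ.filter P).card := by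
  rw [← Finset.card_powerset, Nat.card_eq_fintype_card, Fintype.card_subtype]
  congr 1
  ext f
  simp [Finset.subset_iff]

/-- The primes dividing `e / gcd(k - 1, e)` are the primes `q` dividing `e` with `k ≢ 1` modulo
`q`. -/
theorem card_filter_ne_one {e κ : ℕ} {k : ℤ} (he : Squarefree e)
    (hk : (k : ZMod e) = (κ : ZMod e)) :
    (Finset.univ.filter fun q : e.primeFactors => (κ : ZMod q) ≠ 1).card =
      ArithmeticFunction.cardDistinctFactors (e / Int.gcd (k - 1) e) := by
  have hcast : ∀ q : ℕ, q ∣ e → ((κ : ZMod q) = 1 ↔ q ∣ (k - 1).natAbs) := by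
    intro q hq
    have h1 := congrArg (ZMod.castHom hq (ZMod q)) hk
    simp only [map_intCast, map_natCast] at h1
    rw [← h1, ← Int.natCast_dvd, ← ZMod.intCast_zmod_eq_zero_iff_dvd]
    push_cast
    rw [sub_eq_zero]
  have hgcd : Int.gcd (k - 1) e = Nat.gcd (k - 1).natAbs e := by simp [Int.gcd_eq_natAbs]
  rw [ArithmeticFunction.cardDistinctFactors_apply, hgcd]
  change _ = (e / _).primeFactors.card
  set z := Nat.gcd (k - 1).natAbs e with hz
  have hze : z ∣ e := Nat.gcd_dvd_right _ _
  have hgz : e / z * z = e := Nat.div_mul_cancel hze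
  have hco : Nat.Coprime (e / z) z := Nat.coprime_of_squarefree_mul (by rwa [hgz])
  have hg0 : e / z ≠ 0 := fun h => he.ne_zero (by rw [← hgz, h, zero_mul])
  refine Finset.card_bij (fun q _ => (q : ℕ)) (fun q hq => ?_) (fun _ _ _ _ h => Subtype.ext h)
    (fun q hq => ?_)
  · rw [Finset.mem_filter] at hq
    have hqp := Nat.prime_of_mem_primeFactors q.2
    have hqe := Nat.dvd_of_mem_primeFactors q.2
    refine Nat.mem_primeFactors.2 ⟨hqp, ?_, hg0⟩
    refine (hqp.dvd_mul.1 (by rwa [hgz] : (q : ℕ) ∣ e / z * z)).resolve_right fun h => hq.2 ?_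
    exact (hcast q hqe).2 (h.trans (Nat.gcd_dvd_left _ _))
  · obtain ⟨hqp, hqg, -⟩ := Nat.mem_primeFactors.1 hq
    have hqe : q ∣ e := hqg.trans (Dvd.intro _ hgz)
    refine ⟨⟨q, Nat.mem_primeFactors.2 ⟨hqp, hqe, he.ne_zero⟩⟩, ?_, rfl⟩
    rw [Finset.mem_filter]
    refine ⟨Finset.mem_univ _, fun h => ?_⟩
    exact Nat.not_coprime_of_dvd_of_dvd hqp.one_lt hqg
      (Nat.dvd_gcd ((hcast q hqe).1 h) hqe) hco

/-! ### Counting isomorphism classes -/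

section Count

open CharProduct

variable {d e : ℕ} {χ : AddChar (ZMod d) (∀ q : e.primeFactors, ZMod q)}
  {M A : Type u} [Group M] [Group A]

theorem SkewBraceOver.nonempty_addEquiv (hA : Nonempty (A ≃* Multiplicative (CharProduct χ)))
    (B : SkewBraceOver M A) : Nonempty (B.carrier ≃+ CharProduct χ) := by
  obtain ⟨φ⟩ := hA
  obtain ⟨ψ⟩ := B.add_iso
  exact ⟨AddEquiv.toMultiplicative.symm (ψ.trans φ)⟩

/-- A skew brace forces the commutator subgroup of its multiplicative group to be small. -/
theorem SkewBraceOver.dvd [NeZero d] (he : Squarefree e) (hde : Nat.Coprime d e)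
    (hχ : ∀ r, χ r = 1 → r = 0) (hA : Nonempty (A ≃* Multiplicative (CharProduct χ)))
    {γ N κ : ℕ} {S T : M} (hγ0 : 0 < γ) (hN0 : 0 < N) (hST : IsMetacyclicPair γ N κ S T)
    (hcard : Nat.card M = γ * N) (hκ : IsCoprime ((κ : ℤ) - 1) γ) (B : SkewBraceOver M A) :
    γ ∣ e := by
  obtain ⟨π⟩ := B.nonempty_addEquiv hA
  obtain ⟨φ⟩ := B.mul_iso
  have h := hST.map φ.symm
  have h1 := pow_eq_one_of_skewBrace (hasLifts_primeFactors he hde) hχ π h.pow_left h.mul_eq hκ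
    (e := e) (fun i => (ZMod.natCast_eq_zero_iff _ _).2 (Nat.dvd_of_mem_primeFactors i.2))
  exact h.dvd_of_pow_eq_one hγ0 hN0 (by rw [Nat.card_congr φ.toEquiv, hcard]) h1

/-- Classes correspond to pairs of a set `f` and a unit modulo `gcd δ d`. By `hκδ` and `hord`, the
powers `T ^ r` that act on `S` as `T` does are those with `r ≡ 1` modulo `δ`, and such `r` prime to
`N` connect any two `j` with the same image modulo the gcd. -/
theorem skewBraceCount_eq [NeZero d] (he : Squarefree e) (hde : Nat.Coprime d e)
    (hχ : ∀ r, χ r = 1 → r = 0) (hA : Nonempty (A ≃* Multiplicative (CharProduct χ)))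
    {γ N κ δ : ℕ} {S T : M} (hγ0 : 0 < γ) (hN0 : 0 < N) (hST : IsMetacyclicPair γ N κ S T)
    (hlift : ∀ s t : Equiv.Perm (CharProduct χ), s ^ γ = 1 → t ^ N = 1 → t * s = s ^ κ * t →
      ∃ ρ : M →* Equiv.Perm (CharProduct χ), ρ S = s ∧ ρ T = t)
    (hcard : γ * N = e * d) (hγe : γ ∣ e) (hγN : Nat.Coprime γ N)
    (hκ : IsCoprime ((κ : ℤ) - 1) γ) (hδN : δ ∣ N) (hκδ : κ ^ δ ≡ 1 [MOD γ])
    (hord : ∀ r : ℕ, κ ^ r ≡ κ [MOD γ] → r ≡ 1 [MOD δ]) :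
    skewBraceCount M A =
      ((Nat.card {f : Finset e.primeFactors // ∀ q ∈ f, χ 1 q ≠ 1} * Nat.totient (Nat.gcd δ d) :
        ℕ) : ℕ∞) := by
  classical
  have hL := hasLifts_primeFactors he hde
  have hd0 : 0 < d := Nat.pos_of_ne_zero (NeZero.ne d)
  have : NeZero N := ⟨hN0.ne'⟩
  have hgcd0 : NeZero (Nat.gcd δ d) := ⟨(Nat.gcd_pos_of_pos_right _ hd0).ne'⟩
  set Γ : Finset e.primeFactors := Finset.univ.filter fun q => (q : ℕ) ∣ γ with hΓdef
  have hΓ : ∀ q : e.primeFactors, q ∈ Γ ↔ (γ : ZMod q) = 0 := fun q => by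
    rw [ZMod.natCast_eq_zero_iff]; simp [hΓdef]
  have hprime : ∀ q : e.primeFactors, (q : ℕ).Prime := fun q => Nat.prime_of_mem_primeFactors q.2
  have hNΓ : ∀ q ∈ Γ, (N : ZMod (q : ℕ)) ≠ 0 := by
    intro q hq h0
    rw [hΓ, ZMod.natCast_eq_zero_iff] at hq
    rw [ZMod.natCast_eq_zero_iff] at h0
    exact Nat.not_coprime_of_dvd_of_dvd (hprime q).one_lt hq h0 hγN
  have hN : ∀ q ∉ Γ, (N : ZMod (q : ℕ)) = 0 := by
    intro q hq
    rw [hΓ, ZMod.natCast_eq_zero_iff] at hq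
    rw [ZMod.natCast_eq_zero_iff]
    have h1 : (q : ℕ) ∣ γ * N := hcard ▸ (Nat.dvd_of_mem_primeFactors q.2).mul_right d
    exact ((hprime q).dvd_mul.1 h1).resolve_left hq
  have hdN : d ∣ N := by
    have h1 : d ∣ γ * N := hcard ▸ Dvd.intro_left e rfl
    exact (hde.coprime_dvd_right hγe).dvd_of_dvd_mul_left h1
  have hκN : ∀ q ∈ Γ, (κ : ZMod (q : ℕ)) ^ N = 1 := by
    intro q hq
    rw [hΓ, ZMod.natCast_eq_zero_iff] at hq
    obtain ⟨c, rfl⟩ := hδN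
    have h1 := (ZMod.natCast_eq_natCast_iff _ _ _).2 (hκδ.of_dvd hq)
    push_cast at h1
    rw [pow_mul, h1, one_pow]
  have hγsq : Squarefree γ := he.squarefree_of_dvd hγe
  have hordΓ : ∀ r : ℕ, (∀ q ∈ Γ, (κ : ZMod (q : ℕ)) ^ r = κ) → r ≡ 1 [MOD δ] := by
    intro r hr
    apply hord
    rw [← ZMod.natCast_eq_natCast_iff, hγsq.zmod_natCast_eq_iff]
    intro q hq
    have hq' : q ∈ e.primeFactors := Nat.primeFactors_mono hγe he.ne_zero hq
    have h1 := hr ⟨q, hq'⟩ (by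
      rw [hΓ, ZMod.natCast_eq_zero_iff]; exact Nat.dvd_of_mem_primeFactors hq)
    push_cast
    exact h1
  -- One representative `j` modulo `d` is fixed for each unit modulo `gcd δ d`.
  choose lift hliftu using ZMod.unitsMap_surjective (Nat.gcd_dvd_right δ d)
  have hcard' : γ * N = (∏ q : e.primeFactors, (q : ℕ)) * d := by
    rw [prod_primeFactors_coe he, hcard]
  choose F hF using fun y : {f : Finset e.primeFactors // ∀ q ∈ f, χ 1 q ≠ 1} ×
      (ZMod (Nat.gcd δ d))ˣ => exists_skewBraceOver_hasNormalForm (χ := χ) hL hA hγ0 hN0 hST hlift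
        hcard' (fun q hq => (hΓ q).1 hq) hN hκN hdN y.1.1 (lift y.2).isUnit
  have hbij : Function.Bijective (fun y => (Quotient.mk (SkewBraceOver.isoSetoid M A) (F y))) := by
    constructor
    · intro y y' hyy
      obtain ⟨θ⟩ := Quotient.exact hyy
      obtain ⟨h1, r, h2, h3⟩ := (hF y).unique hL hχ y.1.2 y'.1.2 (lift y'.2).isUnit
        ((hF y').congr θ)
      refine Prod.ext (Subtype.ext h1) ?_
      have h4 := (ZMod.natCast_eq_natCast_iff _ _ _).2
        ((hordΓ r h2).of_dvd (Nat.gcd_dvd_left δ d))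
      rw [← hliftu y.2, ← hliftu y'.2]
      ext1
      rw [ZMod.unitsMap_def, Units.coe_map, Units.coe_map, h3, nsmul_eq_mul]
      change _ = (ZMod.castHom (Nat.gcd_dvd_right δ d) (ZMod (Nat.gcd δ d))) _
      rw [map_mul, map_natCast, h4, Nat.cast_one, one_mul]
      rfl
    · intro q
      obtain ⟨B, rfl⟩ := Quotient.exists_rep q
      obtain ⟨π⟩ := B.nonempty_addEquiv hA
      obtain ⟨φ⟩ := B.mul_iso
      have h := hST.map φ.symm
      obtain ⟨⟨j, hj⟩, -⟩ := exists_hasNormalForm (Γ := Γ) hL hχ π hγ0 h.exists_eq h.pow_left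
        h.pow_right h.mul_eq hκ hΓ hNΓ
      -- Replacing `T` by `T ^ r` moves `j` to the fixed representative; the normal form is then
      -- taken again for the new pair.
      obtain ⟨r, hrN, hrδ, hrj⟩ := exists_coprime_mul_eq hdN hδN
        (hliftu (ZMod.unitsMap (Nat.gcd_dvd_right δ d) j)).symm
      have hκr : κ ^ r ≡ κ [MOD γ] := by
        rw [← ZMod.natCast_eq_natCast_iff] at hκδ ⊢
        push_cast at hκδ ⊢
        simpa using pow_eq_pow_of_modEq hrδ hκδ
      have h' := h.pow_right_pair hrN hκr
      obtain ⟨-, f, hf, hnf⟩ := exists_hasNormalForm (Γ := Γ) hL hχ π hγ0 h'.exists_eq h'.pow_left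
        h'.pow_right h'.mul_eq hκ hΓ hNΓ
      rw [r_pow hL hχ, ← hj, nsmul_eq_mul, hrj] at hnf
      refine ⟨(⟨f, hf⟩, ZMod.unitsMap (Nat.gcd_dvd_right δ d) j), Quotient.sound ?_⟩
      exact (hF _).nonempty_ringEquiv hnf
  rw [skewBraceCount, ← ENat.card_congr (Equiv.ofBijective _ hbij), ENat.card_eq_coe_fintype_card,
    Fintype.card_prod, ZMod.card_units_eq_totient, Nat.card_eq_fintype_card]

end Count

theorem theorem2p1 (n d e δ ε : ℕ) (k κ : ℤ) (hn : Squarefree n)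
    (hde : n = d * e) (hde_coprime : Nat.Coprime d e) (hk : orderOf (k : ZMod e) = d)
    (hδε : n = δ * ε) (hδε_coprime : Nat.Coprime δ ε) (hκ : orderOf (κ : ZMod ε) = δ)
    (M A : Type u) [Group M] [Group A]
    (hM : Nonempty (M ≃* MetacyclicGroup δ ε κ)) (hA : Nonempty (A ≃* MetacyclicGroup d e k))
    (g γ w : ℕ) (hg : g = e / Int.gcd (k - 1) e) (hγ : γ = ε / Int.gcd (κ - 1) ε)
    (hw : w = Nat.totient (Nat.gcd δ d)) :
    skewBraceCount M A =
      ((if γ ∣ e then 2 ^ ArithmeticFunction.cardDistinctFactors g * w else 0 : ℕ) : ℕ∞) := by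
  have hsqde : Squarefree (d * e) := hde ▸ hn
  have hsqδε : Squarefree (δ * ε) := hδε ▸ hn
  obtain ⟨-, hsqd, hsqe⟩ := Nat.squarefree_mul_iff.1 hsqde
  obtain ⟨-, hsqδ, hsqε⟩ := Nat.squarefree_mul_iff.1 hsqδε
  have hd0 : 0 < d := Nat.pos_of_ne_zero hsqd.ne_zero
  have hδ0 : 0 < δ := Nat.pos_of_ne_zero hsqδ.ne_zero
  have he0 : 0 < e := Nat.pos_of_ne_zero hsqe.ne_zero
  have : NeZero d := ⟨hd0.ne'⟩
  have : NeZero e := ⟨he0.ne'⟩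
  have hk' : (k : ZMod e) = ((k : ZMod e).val : ZMod e) := (ZMod.natCast_zmod_val _).symm
  set k' := (k : ZMod e).val
  obtain ⟨χ, hχ1, hχ⟩ := exists_addChar (d := d) (κ := k') hsqe
    (by rw [← hk', ← hk, pow_orderOf_eq_one])
  replace hχ := hχ (by rw [← hk', hk])
  have hA' : Nonempty (A ≃* Multiplicative (CharProduct χ)) := by
    obtain ⟨φ⟩ := CharProduct.nonempty_mulEquiv_metacyclicGroup (χ := χ)
      (hasLifts_primeFactors hsqe hde_coprime) hk' (prod_primeFactors_coe hsqe).symm hd0 he0 hχ1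
    exact hA.map fun ψ => ψ.trans φ
  set ζ := Int.gcd (κ - 1) ε with hζ
  have hζε : ζ ∣ ε := by exact_mod_cast Int.gcd_dvd_right (κ - 1) ε
  have hεγ : ε = γ * ζ := by rw [hγ, Nat.div_mul_cancel hζε]
  have hζκ : (ζ : ℤ) ∣ κ - 1 := Int.gcd_dvd_left _ _
  clear_value ζ
  subst hεγ
  have hγ0 : 0 < γ := Nat.pos_of_ne_zero (left_ne_zero_of_mul hsqε.ne_zero)
  have hζ0 : 0 < ζ := Nat.pos_of_ne_zero (right_ne_zero_of_mul hsqε.ne_zero)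
  have hN0 : 0 < δ * ζ := Nat.mul_pos hδ0 hζ0
  have : NeZero (γ * ζ) := ⟨hsqε.ne_zero⟩
  have hκ' : (κ : ZMod (γ * ζ)) = ((κ : ZMod (γ * ζ)).val : ZMod (γ * ζ)) :=
    (ZMod.natCast_zmod_val _).symm
  set κ' := (κ : ZMod (γ * ζ)).val
  have hκpow : (κ : ZMod (γ * ζ)) ^ δ = 1 := by rw [← hκ, pow_orderOf_eq_one]
  have hκγ : (κ : ZMod γ) = (κ' : ZMod γ) := by
    have := congrArg (ZMod.castHom (Dvd.intro ζ rfl) (ZMod γ)) hκ'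
    simpa using this
  have hκζ : (κ : ZMod ζ) = (κ' : ZMod ζ) := by
    have := congrArg (ZMod.castHom (Dvd.intro_left γ rfl) (ZMod ζ)) hκ'
    simpa using this
  -- Moving the central factor `ζ` to the other side leaves a normal subgroup of order `γ`, the
  -- commutator subgroup, with `κ - 1` prime to `γ`.
  obtain ⟨φ⟩ : Nonempty (M ≃* MetacyclicGroup (δ * ζ) γ κ) := by
    obtain ⟨φ⟩ := MetacyclicGroup.nonempty_mulEquiv hδ0 hsqδε hζκ hκpow
    exact hM.map fun ψ => ψ.trans φ.symm
  have hST := (MetacyclicGroup.isMetacyclicPair (d := δ * ζ) hκγ hN0 hγ0).map φ.symm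
  have hγζ : Nat.Coprime γ ζ := Nat.coprime_of_squarefree_mul hsqε
  have hκcop : IsCoprime ((κ' : ℤ) - 1) γ := by
    obtain ⟨c, hc⟩ : (γ : ℤ) ∣ κ' - κ := by
      rw [← ZMod.intCast_eq_intCast_iff_dvd_sub]; simpa using hκγ
    have h1 : IsCoprime (κ - 1) γ := by
      rw [Int.isCoprime_iff_gcd_eq_one]
      have h2 : Int.gcd (κ - 1) γ ∣ γ := by exact_mod_cast Int.gcd_dvd_right (κ - 1) γ
      have h3 : Int.gcd (κ - 1) γ ∣ ζ := by
        rw [hζ]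
        exact Int.dvd_gcd (Int.gcd_dvd_left _ _) (by exact_mod_cast h2.mul_right ζ)
      exact Nat.eq_one_of_dvd_coprimes hγζ h2 h3
    rw [show (κ' : ℤ) - 1 = κ - 1 + γ * c by linarith]
    exact IsCoprime.add_mul_left_left h1 c
  have hχ1' : ∀ q : e.primeFactors, χ 1 q ≠ 1 ↔ (k' : ZMod q) ≠ 1 := fun q => by rw [hχ1]
  split_ifs with hγe
  · rw [skewBraceCount_eq (δ := δ) hsqe hde_coprime hχ hA' hγ0 hN0 hST ?_ ?_ hγe ?_ hκcop
      (Dvd.intro ζ rfl) ?_ ?_]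
    · classical
      rw [card_normalFormTypes]
      simp only [hχ1']
      rw [card_filter_ne_one hsqe hk', hg, hw]
    · intro s t hs ht hst
      obtain ⟨ρ, h0, h1⟩ := MetacyclicGroup.exists_lift (d := δ * ζ) hκγ hs ht hst
      exact ⟨ρ.comp φ.toMonoidHom, by simpa using h0, by simpa using h1⟩
    · rw [mul_comm e d, ← hde, hδε]; ring
    · rw [show δ * (γ * ζ) = γ * (δ * ζ) by ring] at hsqδε
      exact Nat.coprime_of_squarefree_mul hsqδε
    · rw [← ZMod.natCast_eq_natCast_iff]
      have h := congrArg (ZMod.castHom (Dvd.intro ζ rfl) (ZMod γ)) hκpow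
      rw [map_pow, map_intCast, map_one, hκγ] at h
      push_cast
      exact h
    -- Modulo `ζ` both `κ ^ r` and `κ` are `1`, so the congruence holds modulo `ε = γ * ζ`, where
    -- `κ` has order `δ`.
    · intro r hr
      have h1 : κ' ≡ 1 [MOD ζ] := by
        rw [← ZMod.natCast_eq_natCast_iff, ← hκζ, Nat.cast_one, ← sub_eq_zero]
        have h2 := (ZMod.intCast_zmod_eq_zero_iff_dvd _ _).2 hζκ
        push_cast at h2
        exact h2
      have h2 : κ' ^ r ≡ κ' [MOD ζ] := ((h1.pow r).trans (by rw [one_pow])).trans h1.symm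
      have h3 := (Nat.modEq_and_modEq_iff_modEq_mul hγζ).1 ⟨hr, h2⟩
      rw [← ZMod.natCast_eq_natCast_iff] at h3
      push_cast at h3
      rw [← hκ'] at h3
      have hfin : IsOfFinOrder (κ : ZMod (γ * ζ)) := orderOf_pos_iff.1 (hκ ▸ hδ0)
      obtain ⟨v, hv⟩ := hfin.isUnit
      rw [← hv] at h3 hκ
      rw [orderOf_units] at hκ
      rw [← hκ, ← pow_eq_pow_iff_modEq, pow_one]
      exact_mod_cast h3
  · have hempty : IsEmpty (SkewBraceOver M A) := ⟨fun B => hγe <|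
      B.dvd hsqe hde_coprime hχ hA' hγ0 hN0 hST (by
        rw [Nat.card_congr (hM.some).toEquiv, MetacyclicGroup.card_eq hδ0 hsqε hδε_coprime hκpow]
        ring) hκcop⟩
    have : IsEmpty (Quotient (SkewBraceOver.isoSetoid M A)) :=
      ⟨fun q => hempty.elim (Quotient.exists_rep q).choose⟩
    rw [skewBraceCount, (ENat.card_eq_zero_iff_empty _).2 this, Nat.cast_zero]
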